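/- Let $\xi=(\xi_n)_{n\ge 0}$ be an i.i.d. sequence of random variables with values in a measurable space $\Theta$, and for every $\theta\in\Theta$ let $p(\theta)=(p_k(\theta))_{k\in\mathbb N}$ be a probability distribution on $\mathbb N=\{0,1,2,\dots\}$ depending measurably on $\theta$. Let $(X_{n,i})_{n\ge 0,\,i\ge 1}$ be $\mathbb N$-valued random variables which, conditionally on $\xi$, are independent, $X_{n,i}$ having conditional distribution $p(\xi_n)$. The branching process $(Z_n)_{n\ge 0}$ in the i.i.d. environment $\xi$ is defined by $$Z_0=1,\qquad Z_{n+1}=\sum_{i=1}^{Z_n}X_{n,i},\quad n\ge 0 .$$ Let $m_0=\sum_{k\ge 0}k\,p_k(\xi_0)$, $X=\log m_0$, $\mu=\mathbb E X$ and $\sigma^2=\mathbb E(X-\mu)^2$, $\sigma\ge 0$. Suppose that $p_0(\xi_0)=0$ almost surely, that the process is supercritical, i.e. $\mu>0$, that $\sigma\in(0,\infty)$, that $$\mathbb E\Big[\frac{Z_1}{m_0}\log Z_1\Big]<\infty ,$$ and that there is a constant $\delta\in(0,1)$ with $\mathbb E(\log m_0)^{2+\delta}<\infty$ (in particular $m_0<\infty$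 almost surely). Then $$\limsup_{n\to\infty}\frac{\log Z_n-n\mu}{\sqrt{n\log\log n}}=\sqrt2\,\sigma\quad\text{a.s.}\qquad\text{and}\qquad \liminf_{n\to\infty}\frac{\log Z_n-n\mu}{\sqrt{n\log\log n}}=-\sqrt2\,\sigma\quad\text{a.s.}$$ -/

import Mathlib

open MeasureTheory ProbabilityTheory Filter
open scoped ENNReal

/-- The family of laws `P_ξ`, indexed by a given environment sequence `ξ = (ξ 0, ξ 1, …)`: under
`P_ξ` the offspring numbers `x (n, i)` are independent, and `x (n, i)` has law `p (ξ n)`. -/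
noncomputable def quenchedLaw {Θ : Type*} [MeasurableSpace Θ] (p : Kernel Θ ℕ) [IsMarkovKernel p] :
    Kernel (ℕ → Θ) (ℕ × ℕ → ℕ) where
  toFun ξ := Measure.infinitePi (fun q : ℕ × ℕ => p (ξ q.1))
  measurable' := by
    refine Measurable.measure_of_isPiSystem_of_isProbabilityMeasure
      generateFrom_squareCylinders.symm
      (isPiSystem_squareCylinders (fun _ => MeasurableSpace.isPiSystem_measurableSet)
        (by simp)) ?_
    rintro _ ⟨s, t, ht, rfl⟩
    have ht' : ∀ q, MeasurableSet (t q) := fun q => ht q (Set.mem_univ q)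
    simp_rw [Measure.infinitePi_pi _ (fun q _ => ht' q)]
    exact Finset.measurable_prod _ fun q _ =>
      (p.measurable_coe (ht' q)).comp (measurable_pi_apply q.1)

instance {Θ : Type*} [MeasurableSpace Θ] (p : Kernel Θ ℕ) [IsMarkovKernel p] :
    IsMarkovKernel (quenchedLaw p) :=
  ⟨fun ξ => inferInstanceAs
    (IsProbabilityMeasure (Measure.infinitePi (fun q : ℕ × ℕ => p (ξ q.1))))⟩

/-- `ξ` is an i.i.d. environment with values in `Θ`, and `X n i` is the number of offspring of the
`i`-th particle of generation `n` (particles are numbered from `0`), where `p (ξ n)` is the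
offspring law of generation `n`: the joint law of the environment and of the offspring numbers is
`P(dx, dξ) = P_ξ(dx) τ(dξ)`, with `τ` the law of `ξ`. -/
structure IsBranchingInIIDEnvironment {Ω Θ : Type*} [MeasurableSpace Ω] [MeasurableSpace Θ]
    (P : Measure Ω) (p : Kernel Θ ℕ) [IsMarkovKernel p]
    (ξ : ℕ → Ω → Θ) (X : ℕ → ℕ → Ω → ℕ) : Prop where
  measurable_env : ∀ n, Measurable (ξ n)
  measurable_offspring : ∀ n i, Measurable (X n i)
  indep_env : iIndepFun ξ P
  identDistrib_env : ∀ n, IdentDistrib (ξ n) (ξ 0) P P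
  joint_law :
    P.map (fun ω => ((fun n => ξ n ω), (fun q : ℕ × ℕ => X q.1 q.2 ω))) =
      (P.map (fun ω n => ξ n ω)) ⊗ₘ (quenchedLaw p)

/-- The population sizes: `Z 0 = 1` and `Z (n + 1)` is the sum of the first `Z n` offspring numbers
of generation `n`. -/
def populationSize {Ω : Type*} (X : ℕ → ℕ → Ω → ℕ) : ℕ → Ω → ℕ
  | 0, _ => 1
  | n + 1, ω => ∑ i ∈ Finset.range (populationSize X n ω), X n i ω

/-- The mean `∑ k p_k(θ)` of the offspring law in the environment `θ` (possibly infinite). -/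
noncomputable def offspringMean {Θ : Type*} [MeasurableSpace Θ] (p : Kernel Θ ℕ) (θ : Θ) : ℝ≥0∞ :=
  ∑' k : ℕ, (k : ℝ≥0∞) * p θ {k}

/-- The random variable `log m_0`, as a real number (it is used where `m_0 < ∞` almost surely). -/
noncomputable def logMean {Ω Θ : Type*} [MeasurableSpace Θ] (p : Kernel Θ ℕ) (ξ : ℕ → Ω → Θ)
    (ω : Ω) : ℝ :=
  Real.log (offspringMean p (ξ 0 ω)).toReal

/-! Write log Z_n = S_n + R_n, where S_n is the sum of the log means of the environments of
generations k < n. The walk S_n has i.i.d. steps with mean μ, variance σ² and a moment of order 2 +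
δ, so it obeys the law of the iterated logarithm, and it suffices that R_n = o(√(n log log n))
almost surely (`ae_limsup_liminf_perturbed_sum`).

Law of the iterated logarithm. Upper half: truncate the steps from above at (k+1)^β with β < 1/2,
bound the moment generating functions, and combine the maximal inequality for the exponential
martingale with Borel–Cantelli along θ^j (`ae_eventually_sum_min_le`, `ae_eventually_sum_le`). Lower
half: the central limit theorem bounds from below the probability that a short block has a large
sum; about log j independent short blocks in a row give events of probability at least 1/j, on
disjoint index sets, and the second Borel–Cantelli lemma applies (`ae_frequently_le_sum`).

Upper bound on R_n. The population divided by its quenched mean has expectation at most 1, so by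
Markov and Borel–Cantelli it is eventually below n², whence R_n ≤ 2 log n.

Lower bound on R_n. With ρ the annealed mean of 1/X, the inequality of arithmetic and harmonic means
gives E[1/Z_n] ≤ ρ^n, and ρ < 1 because μ > 0. Truncate the offspring numbers of generation n at s^n
with sρ < 1. Chebyshev and Borel–Cantelli then show that eventually each generation multiplies the
population by at least (1 - ε_n) times the truncated mean, with ε_n summable. The `Z log Z`
condition is exactly what makes the relative loss of mean from truncation summable. Hence R_n ≥ -C
for a random constant C (`IsBranchingInIIDEnvironment.ae_exists_log_populationSize_ge`), without
identifying a martingale limit. -/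

/-! ### Law of the iterated logarithm: upper half -/

/-- Only an upper bound on u enters the remainder, so a variable truncated from above alone can be
inserted. For u ≤ 0 even the factor 1 suffices; for u ≥ 0 the factor exp u does. -/
theorem Real.exp_le_one_add_add_sq_mul_exp {u v : ℝ} (huv : u ≤ v) (hv : 0 ≤ v) :
    Real.exp u ≤ 1 + u + u ^ 2 / 2 * Real.exp v := by
  rcases le_total u 0 with hu | hu
  · have hd : ∀ x : ℝ, HasDerivAt (fun x => 1 + x + x ^ 2 / 2 - Real.exp x)
        (1 + x - Real.exp x) x := fun x => by
      have h := ((((hasDerivAt_id x).const_add 1).add (((hasDerivAt_id x).pow 2).div_const 2)).sub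
        (Real.hasDerivAt_exp x))
      refine HasDerivAt.congr_deriv h ?_
      simp
    have hanti : Antitone (fun x : ℝ => 1 + x + x ^ 2 / 2 - Real.exp x) :=
      antitone_of_deriv_nonpos (fun x => (hd x).differentiableAt) fun x => by
        rw [(hd x).deriv]; linarith [Real.add_one_le_exp x]
    have h := hanti hu
    simp only [Real.exp_zero] at h
    nlinarith [Real.one_le_exp hv, sq_nonneg u]
  · have hd : ∀ x : ℝ, HasDerivAt (fun x => 1 + x + x ^ 2 / 2 * Real.exp x - Real.exp x)
        (Real.exp x * (x ^ 2 / 2 + x - 1 + Real.exp (-x))) x := fun x => by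
      have h := ((((hasDerivAt_id x).const_add 1).add ((((hasDerivAt_id x).pow 2).div_const 2).mul
        (Real.hasDerivAt_exp x))).sub (Real.hasDerivAt_exp x))
      refine HasDerivAt.congr_deriv h ?_
      have : Real.exp x * Real.exp (-x) = 1 := by rw [← Real.exp_add]; simp
      simp
      linear_combination -this
    have hmono : MonotoneOn (fun x : ℝ => 1 + x + x ^ 2 / 2 * Real.exp x - Real.exp x)
        (Set.Ici 0) := by
      refine monotoneOn_of_deriv_nonneg (convex_Ici 0)
        (fun x _ => (hd x).continuousAt.continuousWithinAt)
        (fun x _ => (hd x).differentiableAt.differentiableWithinAt) fun x _ => ?_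
      rw [(hd x).deriv]
      have := Real.add_one_le_exp (-x)
      exact mul_nonneg (Real.exp_pos x).le (by nlinarith [sq_nonneg x])
    have h := hmono Set.self_mem_Ici hu hu
    simp only [Real.exp_zero] at h
    have := Real.exp_le_exp.2 huv
    nlinarith [sq_nonneg u]

/-- Upper truncation makes the moment generating function of a centred variable sub-Gaussian up to
the factor `exp (t * b)`. -/
theorem mgf_min_le {Ω : Type*} [MeasurableSpace Ω] {P : Measure Ω} [IsProbabilityMeasure P]
    {V : Ω → ℝ} (hV2 : MemLp V 2 P) (h0 : ∫ ω, V ω ∂P = 0)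
    (h1 : ∫ ω, V ω ^ 2 ∂P = 1) {t b : ℝ} (ht : 0 ≤ t) (hb : 0 ≤ b) :
    mgf (fun ω => min (V ω) b) P t ≤ Real.exp (t ^ 2 / 2 * Real.exp (t * b)) := by
  have hV1 : Integrable V P := hV2.integrable (by norm_num)
  have hVsq : Integrable (fun ω => V ω ^ 2) P := hV2.integrable_sq
  have hint : Integrable (fun ω => 1 + t * V ω + t ^ 2 / 2 * Real.exp (t * b) * V ω ^ 2) P :=
    ((integrable_const _).add (hV1.const_mul t)).add (hVsq.const_mul _)
  calc mgf (fun ω => min (V ω) b) P t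
      ≤ ∫ ω, (1 + t * V ω + t ^ 2 / 2 * Real.exp (t * b) * V ω ^ 2) ∂P := by
        refine integral_mono_of_nonneg (ae_of_all _ fun ω => (Real.exp_pos _).le) hint
          (ae_of_all _ fun ω => ?_)
        have h := Real.exp_le_one_add_add_sq_mul_exp (u := t * min (V ω) b) (v := t * b)
          (mul_le_mul_of_nonneg_left (min_le_right _ _) ht) (mul_nonneg ht hb)
        -- The truncated variable has mean at most 0; bounding the linear term by t * V avoids
        -- recentring.
        have h2 : t * min (V ω) b ≤ t * V ω := mul_le_mul_of_nonneg_left (min_le_left _ _) ht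
        have h3 : min (V ω) b ^ 2 ≤ V ω ^ 2 := by
          rcases le_total (V ω) b with h | h
          · rw [min_eq_left h]
          · rw [min_eq_right h]; exact pow_le_pow_left₀ hb h 2
        have h4 : (t * min (V ω) b) ^ 2 / 2 * Real.exp (t * b) ≤
            t ^ 2 / 2 * Real.exp (t * b) * V ω ^ 2 := by
          have := mul_le_mul_of_nonneg_left h3
            (by positivity : 0 ≤ t ^ 2 / 2 * Real.exp (t * b))
          linarith
        show Real.exp (t * min (V ω) b) ≤ _
        linarith
    _ = 1 + t ^ 2 / 2 * Real.exp (t * b) := by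
        have e1 : ∫ ω, (1 + t * V ω) ∂P = 1 := by
          rw [integral_add (integrable_const _) (hV1.const_mul t), integral_const_mul, h0]
          simp
        rw [integral_add (f := fun ω => 1 + t * V ω)
          ((integrable_const _).add (hV1.const_mul t)) (hVsq.const_mul _), e1,
          integral_const_mul, h1, mul_one]
    _ ≤ _ := by
        rw [add_comm]; exact Real.add_one_le_exp _

/-- Exponential maximal inequality for sums of independent variables. -/
theorem measure_exists_sum_ge_le {Ω : Type*} [MeasurableSpace Ω] {P : Measure Ω}
    [IsProbabilityMeasure P] {Y : ℕ → Ω → ℝ} (hYm : ∀ k, Measurable (Y k)) (hY : iIndepFun Y P)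
    {t A ℓ : ℝ} (n : ℕ) (hA : 1 ≤ A)
    (hint : ∀ k, Integrable (fun ω => Real.exp (t * Y k ω)) P)
    (hmgf : ∀ k < n, mgf (Y k) P t ≤ A) :
    P {ω | ∃ k ≤ n, ℓ ≤ t * ∑ i ∈ Finset.range k, Y i ω} ≤
      ENNReal.ofReal (A ^ n * Real.exp (-ℓ)) := by
  have hpos : ∀ k, 0 < mgf (Y k) P t := fun k => mgf_pos (hint k)
  -- Factors normalised to mean 1, so that their partial products form a martingale.
  set g : ℕ → Ω → ℝ := fun k ω => Real.exp (t * Y k ω) / mgf (Y k) P t with hg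
  have hgm : ∀ k, Measurable (g k) := fun k => by
    have := hYm k; simp only [hg]; fun_prop
  have hgpos : ∀ k ω, 0 < g k ω := fun k ω => div_pos (Real.exp_pos _) (hpos k)
  have hgint : ∀ k, Integrable (g k) P := fun k => (hint k).div_const _
  have hg1 : ∀ k, ∫ ω, g k ω ∂P = 1 := fun k => by
    simp only [hg]; rw [integral_div]; exact div_self (hpos k).ne'
  have hgind : iIndepFun g P :=
    hY.comp (fun k x => Real.exp (t * x) / mgf (Y k) P t) (fun k => by fun_prop)
  have hgsm : ∀ k, StronglyMeasurable (g k) := fun k => (hgm k).stronglyMeasurable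
  set M : ℕ → Ω → ℝ := fun k => ∏ i ∈ Finset.range (k + 1), g i with hM
  have hMsucc : ∀ k, M (k + 1) = M k * g (k + 1) := fun k => Finset.prod_range_succ _ _
  have hMint : ∀ k, Integrable (M k) P := by
    intro k
    induction k with
    | zero => simpa [hM] using hgint 0
    | succ k ih =>
      rw [hMsucc]
      exact (hgind.indepFun_prod_range_succ hgm (k + 1)).integrable_mul ih (hgint _)
  have hM1 : ∀ k, ∫ ω, M k ω ∂P = 1 := by
    intro k
    induction k with
    | zero => simpa [hM] using hg1 0
    | succ k ih =>
      rw [hMsucc, (hgind.indepFun_prod_range_succ hgm (k + 1)).integral_mul_eq_mul_integral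
        (hMint k).aestronglyMeasurable (hgint _).aestronglyMeasurable, hg1, mul_one]
      exact ih
  have hadapt : StronglyAdapted (Filtration.natural g hgsm) M := fun k =>
    Finset.stronglyMeasurable_prod _ fun i hi =>
      (Filtration.stronglyAdapted_natural hgsm i).mono
        ((Filtration.natural g hgsm).mono (by simpa [Nat.lt_succ_iff] using hi))
  have hmart : Martingale M (Filtration.natural g hgsm) P := by
    refine martingale_nat hadapt hMint fun k => ?_
    have h1 := condExp_mul_of_stronglyMeasurable_left (hadapt k)
      (by rw [← hMsucc]; exact hMint _) (hgint (k + 1)) (μ := P)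
    have h2 := hgind.condExp_natural_ae_eq_of_lt hgsm (Nat.lt_succ_self k)
    rw [hMsucc]
    filter_upwards [h1, h2] with ω h1 h2
    rw [h1, Pi.mul_apply, h2, hg1, mul_one]
  have hMnn : 0 ≤ M := fun k ω => by
    simp only [hM, Finset.prod_apply]
    exact Finset.prod_nonneg fun i _ => (hgpos i ω).le
  have hAn : 0 < A ^ n := by positivity
  rcases le_or_gt ℓ 0 with hℓ | hℓ
  · refine prob_le_one.trans ?_
    rw [ENNReal.one_le_ofReal]
    exact one_le_mul_of_one_le_of_one_le (one_le_pow₀ hA) (Real.one_le_exp (by linarith))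
  -- Since now ℓ > 0, the empty sum never reaches the level. `M j` contains j + 1 factors, so the
  -- maximal inequality is run up to n - 1.
  rcases Nat.eq_zero_or_pos n with rfl | hn
  · have : {ω | ∃ k ≤ 0, ℓ ≤ t * ∑ i ∈ Finset.range k, Y i ω} = ∅ := by
      ext ω
      simpa using hℓ
    rw [this]; simp
  -- exp(t S_k) is the martingale times a product of at most n moment generating functions, each at
  -- most A with A ≥ 1; this fixes the level.
  set ε : NNReal := ⟨Real.exp ℓ / A ^ n, by positivity⟩ with hε
  have hmax := maximal_ineq hmart.submartingale hMnn (ε := ε) (n - 1)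
  have hsub : {ω | ∃ k ≤ n, ℓ ≤ t * ∑ i ∈ Finset.range k, Y i ω} ⊆
      {ω | (ε : ℝ) ≤ (Finset.range (n - 1 + 1)).sup' Finset.nonempty_range_add_one
        fun k => M k ω} := by
    rintro ω ⟨k, hkn, hk⟩
    have hk0 : k ≠ 0 := by
      rintro rfl
      simp at hk; linarith
    obtain ⟨j, rfl⟩ := Nat.exists_eq_succ_of_ne_zero hk0
    refine le_trans ?_ (Finset.le_sup' (fun k => M k ω) (b := j) (by simp; omega))
    show Real.exp ℓ / A ^ n ≤ M j ω
    have hprod : M j ω = Real.exp (t * ∑ i ∈ Finset.range (j + 1), Y i ω) /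
        ∏ i ∈ Finset.range (j + 1), mgf (Y i) P t := by
      simp only [hM, hg, Finset.prod_apply, Finset.prod_div_distrib, ← Real.exp_sum,
        Finset.mul_sum]
    rw [hprod]
    refine div_le_div₀ (Real.exp_pos _).le (Real.exp_le_exp.2 hk)
      (Finset.prod_pos fun i _ => hpos i) ?_
    calc ∏ i ∈ Finset.range (j + 1), mgf (Y i) P t ≤ ∏ i ∈ Finset.range (j + 1), A :=
          Finset.prod_le_prod (fun i _ => (hpos i).le)
            fun i hi => hmgf i (by simp at hi; omega)
      _ = A ^ (j + 1) := by simp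
      _ ≤ A ^ n := pow_le_pow_right₀ hA hkn
  have hle : (ε : ℝ≥0∞) * P {ω | ∃ k ≤ n, ℓ ≤ t * ∑ i ∈ Finset.range k, Y i ω} ≤ 1 := by
    refine (mul_le_mul_right (measure_mono hsub) _).trans (hmax.trans ?_)
    rw [← ENNReal.ofReal_one, ← hM1 (n - 1)]
    exact ENNReal.ofReal_le_ofReal
      (setIntegral_le_integral (hMint _) (ae_of_all _ fun ω => hMnn _ ω))
  have hεpos : 0 < Real.exp ℓ / A ^ n := by positivity
  have hε' : (ε : ℝ≥0∞) = ENNReal.ofReal (Real.exp ℓ / A ^ n) := by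
    rw [ENNReal.ofReal, Real.toNNReal_of_nonneg hεpos.le]; rfl
  rw [hε', mul_comm] at hle
  have := ENNReal.le_div_iff_mul_le (Or.inl (by simpa using hεpos)) (Or.inl ENNReal.ofReal_ne_top)
    |>.2 hle
  refine this.trans (le_of_eq ?_)
  rw [one_div, ← ENNReal.ofReal_inv_of_pos hεpos]
  congr 1
  rw [Real.exp_neg]; field_simp

open scoped Topology in
-- With Λ = log log x, the choice t = (c/θ)√(Λ/x) minimises -t c√(xΛ) + θx t²/2, with value
-- -c²Λ/(2θ). Taking 1 < θ < c²/2 leaves room for q > 1. The truncation factor tends to 1 because t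
-- x^β → 0 for β < 1/2.
theorem exists_exponent_iteratedLog_upper {c β : ℝ} (hc : Real.sqrt 2 < c) (hβ : β < 1 / 2) :
    ∃ θ > (1 : ℝ), ∃ q > (1 : ℝ), ∀ᶠ x : ℝ in atTop,
      -(c / θ * Real.sqrt (Real.log (Real.log x) / x) * (c * Real.sqrt (x * Real.log (Real.log x))))
        + ⌈θ * x⌉₊ * ((c / θ * Real.sqrt (Real.log (Real.log x) / x)) ^ 2 / 2 *
          Real.exp (c / θ * Real.sqrt (Real.log (Real.log x) / x) * (⌈θ * x⌉₊ : ℝ) ^ β)) ≤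
        -q * Real.log (Real.log x) := by
  have hc0 : 0 < c := lt_of_le_of_lt (Real.sqrt_nonneg _) hc
  have hc2 : 2 < c ^ 2 := by
    have := Real.sq_sqrt (show (0:ℝ) ≤ 2 by norm_num)
    nlinarith [Real.sqrt_nonneg 2]
  obtain ⟨θ, hθ1, hθc⟩ : ∃ θ, 1 < θ ∧ θ < c ^ 2 / 2 := exists_between (by linarith)
  have hθ0 : 0 < θ := by linarith
  have hq : 1 < c ^ 2 / (2 * θ) := by rw [lt_div_iff₀ (by positivity)]; linarith
  obtain ⟨q, hq1, hqc⟩ := exists_between hq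
  refine ⟨θ, hθ1, q, hq1, ?_⟩
  have hN : Tendsto (fun x : ℝ => (⌈θ * x⌉₊ : ℝ) / x) atTop (𝓝 θ) :=
    tendsto_nat_ceil_mul_div_atTop hθ0.le
  have hlog : ∀ᶠ x : ℝ in atTop, 1 ≤ Real.log x := Real.tendsto_log_atTop.eventually_ge_atTop 1
  have hll : Tendsto (fun x : ℝ => Real.sqrt (Real.log (Real.log x) / x ^ (1 - 2 * β))) atTop
      (𝓝 0) := by
    rw [← Real.sqrt_zero]
    refine Tendsto.sqrt (squeeze_zero' ?_ ?_
      (isLittleO_log_rpow_atTop (r := 1 - 2 * β) (by linarith)).tendsto_div_nhds_zero)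
    · filter_upwards [hlog, eventually_gt_atTop 0] with x hx hx0
      exact div_nonneg (Real.log_nonneg hx) (Real.rpow_nonneg hx0.le _)
    · filter_upwards [hlog, eventually_gt_atTop 0] with x hx hx0
      exact div_le_div_of_nonneg_right (Real.log_le_self (by linarith)) (Real.rpow_nonneg hx0.le _)
  have htN : Tendsto (fun x : ℝ => c / θ * Real.sqrt (Real.log (Real.log x) / x) *
      (⌈θ * x⌉₊ : ℝ) ^ β) atTop (𝓝 0) := by
    have h := (hll.const_mul (c / θ)).mul (hN.rpow_const (p := β) (Or.inl hθ0.ne'))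
    simp only [mul_zero, zero_mul] at h
    refine h.congr' ?_
    filter_upwards [hlog, eventually_gt_atTop 0] with x hx hx0
    rw [mul_assoc, mul_assoc]
    congr 1
    rw [Real.div_rpow (by positivity) hx0.le, Real.rpow_sub hx0, Real.rpow_one,
      show 2 * β = β + β by ring, Real.rpow_add hx0,
      show Real.log (Real.log x) / (x / (x ^ β * x ^ β)) =
        Real.log (Real.log x) / x * (x ^ β) ^ 2 by
        have := Real.rpow_pos_of_pos hx0 β
        field_simp,
      Real.sqrt_mul' _ (sq_nonneg _), Real.sqrt_sq (Real.rpow_nonneg hx0.le _)]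
    have := Real.rpow_pos_of_pos hx0 β
    field_simp
  have hfac : Tendsto (fun x : ℝ => c ^ 2 / θ * (1 - (⌈θ * x⌉₊ : ℝ) / x / (2 * θ) *
      Real.exp (c / θ * Real.sqrt (Real.log (Real.log x) / x) * (⌈θ * x⌉₊ : ℝ) ^ β))) atTop
      (𝓝 (c ^ 2 / (2 * θ))) := by
    have h := (((hN.div_const (2 * θ)).mul (Real.continuous_exp.continuousAt.tendsto.comp
      htN)).const_sub 1).const_mul (c ^ 2 / θ)
    have e : c ^ 2 / θ * (1 - θ / (2 * θ) * Real.exp 0) = c ^ 2 / (2 * θ) := by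
      rw [Real.exp_zero]; field_simp; norm_num
    rw [e] at h
    exact h
  filter_upwards [hfac.eventually_const_lt hqc, hlog, eventually_gt_atTop 0] with x hx hlx hx0
  have hΛ : 0 ≤ Real.log (Real.log x) := Real.log_nonneg hlx
  set Λ := Real.log (Real.log x) with hΛdef
  set E := Real.exp (c / θ * Real.sqrt (Λ / x) * (⌈θ * x⌉₊ : ℝ) ^ β) with hE
  have h1 : Real.sqrt (Λ / x) * Real.sqrt (x * Λ) = Λ := by
    rw [← Real.sqrt_mul (by positivity), show Λ / x * (x * Λ) = Λ ^ 2 by field_simp,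
      Real.sqrt_sq hΛ]
  have h2 : Real.sqrt (Λ / x) ^ 2 = Λ / x := Real.sq_sqrt (by positivity)
  have h3 : -(c / θ * Real.sqrt (Λ / x) * (c * Real.sqrt (x * Λ))) +
      ⌈θ * x⌉₊ * ((c / θ * Real.sqrt (Λ / x)) ^ 2 / 2 * E) =
      -(c ^ 2 / θ * (1 - (⌈θ * x⌉₊ : ℝ) / x / (2 * θ) * E)) * Λ := by
    rw [mul_pow, h2, show c / θ * Real.sqrt (Λ / x) * (c * Real.sqrt (x * Λ)) =
      c / θ * c * (Real.sqrt (Λ / x) * Real.sqrt (x * Λ)) by ring, h1]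
    field_simp
    ring
  rw [h3]
  nlinarith [mul_le_mul_of_nonneg_right hx.le hΛ]

theorem ENNReal.tsum_ne_top_of_eventually_le_ofReal {f : ℕ → ℝ≥0∞} {g : ℕ → ℝ}
    (hf : ∀ n, f n ≠ ∞) (hg : Summable g) (hfg : ∀ᶠ n in atTop, f n ≤ ENNReal.ofReal (g n)) :
    ∑' n, f n ≠ ∞ := by
  obtain ⟨N, hN⟩ := eventually_atTop.1 hfg
  rw [← Summable.sum_add_tsum_nat_add' (k := N) ENNReal.summable]
  refine ENNReal.add_ne_top.2 ⟨ENNReal.sum_ne_top.2 fun n _ => hf n, ?_⟩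
  exact ne_top_of_le_ne_top ((summable_nat_add_iff N).2 hg).tsum_ofReal_ne_top
    (ENNReal.tsum_le_tsum fun n => hN _ (by omega))

theorem tendsto_sqrt_mul_log_log_atTop :
    Tendsto (fun n : ℕ => Real.sqrt (n * Real.log (Real.log n))) atTop atTop :=
  Real.tendsto_sqrt_atTop.comp (Tendsto.atTop_mul_atTop₀ tendsto_natCast_atTop_atTop
    (Real.tendsto_log_atTop.comp (Real.tendsto_log_atTop.comp tendsto_natCast_atTop_atTop)))

/-- Upper half of the law of the iterated logarithm for upper truncated variables. -/
theorem ae_eventually_sum_min_le {Ω : Type*} [MeasurableSpace Ω] {P : Measure Ω}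
    [IsProbabilityMeasure P] {V : ℕ → Ω → ℝ} (hVm : ∀ k, Measurable (V k)) (hV : iIndepFun V P)
    (hid : ∀ k, IdentDistrib (V k) (V 0) P P) (hV2 : MemLp (V 0) 2 P) (h0 : ∫ ω, V 0 ω ∂P = 0)
    (h1 : ∫ ω, V 0 ω ^ 2 ∂P = 1) {β c : ℝ} (hβ0 : 0 < β) (hβ : β < 1 / 2)
    (hc : Real.sqrt 2 < c) :
    ∀ᵐ ω ∂P, ∀ᶠ n : ℕ in atTop,
      ∑ k ∈ Finset.range n, min (V k ω) ((k + 1 : ℝ) ^ β) ≤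
        c * Real.sqrt (n * Real.log (Real.log n)) := by
  have hc0 : 0 < c := lt_of_le_of_lt (Real.sqrt_nonneg _) hc
  obtain ⟨θ, hθ, q, hq, hev⟩ := exists_exponent_iteratedLog_upper hc hβ
  have hθ0 : 0 < θ := by linarith
  have hθpow : Tendsto (fun j : ℕ => θ ^ j) atTop atTop := tendsto_pow_atTop_atTop_of_one_lt hθ
  set Y : ℕ → Ω → ℝ := fun k ω => min (V k ω) ((k + 1 : ℝ) ^ β) with hYdef
  have hYm : ∀ k, Measurable (Y k) := fun k => (hVm k).min measurable_const
  have hYind : iIndepFun Y P :=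
    hV.comp (fun k x => min x ((k + 1 : ℝ) ^ β)) (fun k => measurable_id.min measurable_const)
  set L : ℝ → ℝ := fun x => Real.sqrt (x * Real.log (Real.log x)) with hL
  set t : ℝ → ℝ := fun x => c / θ * Real.sqrt (Real.log (Real.log x) / x) with ht
  have ht0 : ∀ x, 0 ≤ t x := fun x => by simp only [ht]; positivity
  have hbnd : ∀ᶠ j : ℕ in atTop, P {ω | ∃ k ≤ ⌈θ * θ ^ j⌉₊, t (θ ^ j) * (c * L (θ ^ j)) ≤
      t (θ ^ j) * ∑ i ∈ Finset.range k, Y i ω} ≤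
        ENNReal.ofReal (Real.log θ ^ (-q) * (1 / (j : ℝ) ^ q)) := by
    filter_upwards [hθpow.eventually hev, eventually_gt_atTop 0] with j hj hj0
    set x := θ ^ j with hx
    -- The bound for the moment generating function at the highest truncation level occurring up to
    -- time ⌈θx⌉.
    set A := Real.exp (t x ^ 2 / 2 * Real.exp (t x * (⌈θ * x⌉₊ : ℝ) ^ β)) with hA
    refine (measure_exists_sum_ge_le hYm hYind (A := A) _ (Real.one_le_exp (by positivity))
      (fun k => ?_) (fun k hk => ?_)).trans (ENNReal.ofReal_le_ofReal ?_)
    · refine Integrable.of_bound (C := Real.exp (t x * (k + 1 : ℝ) ^ β))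
        (by have := hYm k; fun_prop) (ae_of_all _ fun ω => ?_)
      rw [Real.norm_of_nonneg (Real.exp_pos _).le]
      exact Real.exp_le_exp.2 (mul_le_mul_of_nonneg_left (min_le_right _ _) (ht0 x))
    · have hidk : IdentDistrib (V k) (V 0) P P := hid k
      have hmean : ∫ ω, V k ω ∂P = 0 := by rw [hidk.integral_eq, h0]
      have hsq : ∫ ω, V k ω ^ 2 ∂P = 1 := by rw [← h1]; exact hidk.sq.integral_eq
      refine (mgf_min_le (hidk.symm.memLp_snd hV2) hmean hsq (ht0 x)
        (Real.rpow_nonneg (by positivity) _)).trans ?_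
      refine Real.exp_le_exp.2 (mul_le_mul_of_nonneg_left (Real.exp_le_exp.2
        (mul_le_mul_of_nonneg_left (Real.rpow_le_rpow (by positivity) ?_ hβ0.le) (ht0 x)))
        (by positivity))
      exact_mod_cast hk
    · rw [hA, ← Real.exp_nat_mul, ← Real.exp_add, add_comm]
      refine (Real.exp_le_exp.2 hj).trans (le_of_eq ?_)
      have hlθ : 0 < Real.log θ := Real.log_pos hθ
      have hj' : (0 : ℝ) < j := by exact_mod_cast hj0
      -- At x = θ^j one has log log x = log(j log θ), so exp(-q log log x) = (j log θ)^(-q), which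
      -- is summable.
      rw [hx, Real.log_pow, mul_comm (-q), ← Real.rpow_def_of_pos (by positivity),
        Real.mul_rpow hj'.le hlθ.le, Real.rpow_neg hj'.le, mul_comm, one_div]
  have hsum : ∑' j, P {ω | ∃ k ≤ ⌈θ * θ ^ j⌉₊, t (θ ^ j) * (c * L (θ ^ j)) ≤
      t (θ ^ j) * ∑ i ∈ Finset.range k, Y i ω} ≠ ∞ :=
    ENNReal.tsum_ne_top_of_eventually_le_ofReal (fun _ => measure_ne_top _ _)
      ((Real.summable_one_div_nat_rpow.2 hq).mul_left _) hbnd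
  have hBC := ae_eventually_notMem hsum
  filter_upwards [hBC] with ω hω
  have htpos : ∀ᶠ j : ℕ in atTop, 0 < t (θ ^ j) := by
    have h := (Real.tendsto_log_atTop.comp Real.tendsto_log_atTop).comp hθpow
    filter_upwards [h.eventually_gt_atTop 0] with j hj
    have : 0 < θ ^ j := by positivity
    exact mul_pos (by positivity) (Real.sqrt_pos.2 (div_pos hj this))
  obtain ⟨J, hJ⟩ := eventually_atTop.1 (hω.and (htpos.and
    ((Real.tendsto_log_atTop.comp hθpow).eventually_ge_atTop 1)))
  filter_upwards [eventually_ge_atTop ⌈θ ^ J⌉₊] with n hn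
  have hn' : θ ^ J ≤ n := Nat.ceil_le.1 hn
  have hn1 : (1 : ℝ) ≤ n := (one_le_pow₀ hθ.le).trans hn'
  -- With θ^j ≤ n < θ^(j+1), time n is covered by the j-th event, and the level at θ^j is at most
  -- the level at n.
  obtain ⟨j, hj1, hj2⟩ := exists_nat_pow_near hn1 hθ
  have hJj : J ≤ j := by
    have := (pow_lt_pow_iff_right₀ hθ).1 (hn'.trans_lt hj2)
    omega
  obtain ⟨hω1, hω2, hω3⟩ := hJ j hJj
  simp only [not_exists, not_and, not_le] at hω1
  have h3 := hω1 n (by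
    have : (n : ℝ) ≤ ⌈θ * θ ^ j⌉₊ := by
      rw [← pow_succ']; exact hj2.le.trans (Nat.le_ceil _)
    exact_mod_cast this)
  have h4 := lt_of_mul_lt_mul_left h3 hω2.le
  refine h4.le.trans (mul_le_mul_of_nonneg_left (Real.sqrt_le_sqrt ?_) hc0.le)
  have hω3' : 1 ≤ Real.log (θ ^ j) := hω3
  have hxp : 0 < θ ^ j := by positivity
  have hl : Real.log (θ ^ j) ≤ Real.log n := Real.log_le_log hxp hj1
  exact mul_le_mul hj1 (Real.log_le_log (by linarith) hl) (Real.log_nonneg hω3') (by linarith)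

/-- Upper half of the law of the iterated logarithm for independent identically distributed
variables with a moment of order greater than `2`. -/
theorem ae_eventually_sum_le {Ω : Type*} [MeasurableSpace Ω] {P : Measure Ω}
    [IsProbabilityMeasure P] {V : ℕ → Ω → ℝ} (hVm : ∀ k, Measurable (V k)) (hV : iIndepFun V P)
    (hid : ∀ k, IdentDistrib (V k) (V 0) P P) (hV2 : MemLp (V 0) 2 P) (h0 : ∫ ω, V 0 ω ∂P = 0)
    (h1 : ∫ ω, V 0 ω ^ 2 ∂P = 1) {γ c : ℝ} (hγ : 2 < γ)
    (hint : Integrable (fun ω => |V 0 ω| ^ γ) P) (hc : Real.sqrt 2 < c) :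
    ∀ᵐ ω ∂P, ∀ᶠ n : ℕ in atTop,
      ∑ k ∈ Finset.range n, V k ω ≤ c * Real.sqrt (n * Real.log (Real.log n)) := by
  -- β > 1/γ makes the exceedance probabilities summable by Markov; β < 1/2 is what the truncated
  -- law requires.
  obtain ⟨β, hβγ, hβ⟩ : ∃ β, 1 / γ < β ∧ β < 1 / 2 :=
    exists_between (one_div_lt_one_div_of_lt (by norm_num) hγ)
  have hγ0 : 0 < γ := by linarith
  have hβ0 : 0 < β := lt_trans (by positivity) hβγ
  have hβγ' : 1 < γ * β := by
    rw [div_lt_iff₀ hγ0] at hβγ; linarith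
  obtain ⟨d, hd, hdc⟩ := exists_between hc
  have hsum : ∑' k : ℕ, P {ω | (k + 1 : ℝ) ^ β ≤ V k ω} ≠ ∞ := by
    refine ENNReal.tsum_ne_top_of_eventually_le_ofReal (fun _ => measure_ne_top _ _)
      (g := fun k => (∫ ω, |V 0 ω| ^ γ ∂P) * (1 / (((k + 1 : ℕ) : ℝ) ^ (γ * β))))
      (((summable_nat_add_iff 1).2 (Real.summable_one_div_nat_rpow.2 hβγ')).mul_left _)
      (Eventually.of_forall fun k => ?_)
    have hk : (0 : ℝ) < ((k + 1 : ℕ) : ℝ) := by positivity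
    have e1 : P {ω | (k + 1 : ℝ) ^ β ≤ V k ω} = P {ω | (k + 1 : ℝ) ^ β ≤ V 0 ω} :=
      (hid k).measure_mem_eq (s := Set.Ici ((k + 1 : ℝ) ^ β)) measurableSet_Ici
    have e2 : {ω | (k + 1 : ℝ) ^ β ≤ V 0 ω} ⊆
        {ω | ((k + 1 : ℕ) : ℝ) ^ (γ * β) ≤ |V 0 ω| ^ γ} := fun ω hω => by
      have hω' : ((k + 1 : ℕ) : ℝ) ^ β ≤ |V 0 ω| := by
        push_cast; exact le_trans hω (le_abs_self _)
      show ((k + 1 : ℕ) : ℝ) ^ (γ * β) ≤ _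
      rw [mul_comm, Real.rpow_mul hk.le]
      exact Real.rpow_le_rpow (by positivity) hω' hγ0.le
    have e3 := mul_meas_ge_le_integral_of_nonneg
      (ae_of_all P fun ω => Real.rpow_nonneg (abs_nonneg (V 0 ω)) γ) hint
      (((k + 1 : ℕ) : ℝ) ^ (γ * β))
    rw [e1]
    refine (measure_mono e2).trans ?_
    rw [← ofReal_measureReal]
    refine ENNReal.ofReal_le_ofReal ?_
    rw [mul_one_div, le_div_iff₀ (by positivity), mul_comm]
    exact e3
  filter_upwards [ae_eventually_notMem hsum,
    ae_eventually_sum_min_le hVm hV hid hV2 h0 h1 hβ0 hβ hd] with ω h2 h3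
  obtain ⟨N, hN⟩ := eventually_atTop.1 h2
  -- Truncation changes only finitely many terms; their total D is absorbed by the gap between d and
  -- c.
  set D := ∑ k ∈ Finset.range N, (V k ω - min (V k ω) ((k + 1 : ℝ) ^ β)) with hD
  filter_upwards [h3, eventually_ge_atTop N,
    tendsto_sqrt_mul_log_log_atTop.eventually_ge_atTop (D / (c - d))] with n hn hnN hnD
  have e : ∑ k ∈ Finset.range n, (V k ω - min (V k ω) ((k + 1 : ℝ) ^ β)) = D := by
    rw [hD]
    refine (Finset.sum_subset (Finset.range_subset_range.2 hnN) fun k _ hk => ?_).symm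
    have := hN k (by simpa using hk)
    have h' : V k ω < (k + 1 : ℝ) ^ β := not_le.1 this
    rw [min_eq_left h'.le, sub_self]
  rw [Finset.sum_sub_distrib] at e
  rw [div_le_iff₀ (by linarith)] at hnD
  linarith

/-! ### Law of the iterated logarithm: lower half -/

/-- The interval (y, y+1] alone has mass at least exp(-C - (y+1)²/2), where exp C = √(2π). The
surplus C + y + 1/2 in the exponent is below ε y²/2 once y ≥ 1 and ε y ≥ 2C + 4. -/
theorem exists_exp_lt_gaussianReal_Ioi {ε : ℝ} (hε : 0 < ε) :
    ∃ y > (0 : ℝ), ENNReal.ofReal (Real.exp (-(1 + ε) * (y ^ 2 / 2))) <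
      gaussianReal 0 1 (Set.Ioi y) := by
  set C := Real.log (Real.sqrt (2 * Real.pi)) with hC
  have hs1 : 1 ≤ Real.sqrt (2 * Real.pi) := by
    rw [Real.one_le_sqrt]; nlinarith [Real.pi_gt_three]
  have hC0 : 0 ≤ C := Real.log_nonneg hs1
  set y := 1 + (2 * C + 4) / ε with hy
  have hy1 : 1 ≤ y := by
    have : 0 ≤ (2 * C + 4) / ε := by positivity
    linarith
  have hyε : 2 * C + 4 ≤ ε * y := by
    have : ε * y = ε + (2 * C + 4) := by rw [hy]; field_simp
    linarith
  refine ⟨y, by linarith, ?_⟩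
  have hpdf : ∀ x ∈ Set.Ioc y (y + 1),
      ENNReal.ofReal (Real.exp (-C - (y + 1) ^ 2 / 2)) ≤ gaussianPDF 0 1 x := fun x hx => by
    rw [gaussianPDF, gaussianPDFReal]
    refine ENNReal.ofReal_le_ofReal ?_
    rw [sub_eq_add_neg, Real.exp_add, Real.exp_neg C, hC, Real.exp_log (by linarith)]
    simp only [NNReal.coe_one, mul_one, sub_zero]
    refine mul_le_mul_of_nonneg_left (Real.exp_le_exp.2 ?_) (by positivity)
    have := pow_le_pow_left₀ (by linarith [hx.1]) hx.2 2
    linarith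
  calc ENNReal.ofReal (Real.exp (-(1 + ε) * (y ^ 2 / 2)))
      < ENNReal.ofReal (Real.exp (-C - (y + 1) ^ 2 / 2)) := by
        rw [ENNReal.ofReal_lt_ofReal_iff (Real.exp_pos _), Real.exp_lt_exp]
        nlinarith
    _ = ∫⁻ x in Set.Ioc y (y + 1), ENNReal.ofReal (Real.exp (-C - (y + 1) ^ 2 / 2)) := by
        simp
    _ ≤ ∫⁻ x in Set.Ioc y (y + 1), gaussianPDF 0 1 x :=
        setLIntegral_mono (measurable_gaussianPDF 0 1) hpdf
    _ = gaussianReal 0 1 (Set.Ioc y (y + 1)) := (gaussianReal_apply _ one_ne_zero _).symm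
    _ ≤ gaussianReal 0 1 (Set.Ioi y) := measure_mono Set.Ioc_subset_Ioi_self

theorem measurableSet_iSup_comap_sum_ge {Ω : Type*} {V : ℕ → Ω → ℝ} {S : Finset ℕ} {T : Set ℕ}
    (hST : ∀ k ∈ S, k ∈ T) (r : ℝ) :
    MeasurableSet[⨆ k ∈ T, MeasurableSpace.comap (V k) inferInstance]
      {ω | r ≤ ∑ k ∈ S, V k ω} := by
  have h : Measurable[⨆ k ∈ T, MeasurableSpace.comap (V k) inferInstance]
      (fun ω => ∑ k ∈ S, V k ω) := by
    refine @Finset.measurable_sum _ _ _ _ _ _ (_) _ S fun k hk => ?_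
    exact (comap_measurable (V k)).mono
      (le_iSup₂_of_le (f := fun k (_ : k ∈ T) => MeasurableSpace.comap (V k) _) k (hST k hk)
        le_rfl) le_rfl
  exact h measurableSet_Ici

/-- Central limit theorem and the portmanteau inequality for the open half-line. The strict Gaussian
bound passes to all large m at a fixed level y. -/
theorem exists_exp_le_measure_sum_ge {Ω : Type*} [MeasurableSpace Ω] {P : Measure Ω} [IsProbabilityMeasure P]
    {V : ℕ → Ω → ℝ} (hV : iIndepFun V P)
    (hid : ∀ k, IdentDistrib (V k) (V 0) P P) (h0 : ∫ ω, V 0 ω ∂P = 0)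
    (h1 : ∫ ω, V 0 ω ^ 2 ∂P = 1) {ε : ℝ} (hε : 0 < ε) :
    ∃ y > (0 : ℝ), ∀ᶠ m : ℕ in atTop, ENNReal.ofReal (Real.exp (-(1 + ε) * (y ^ 2 / 2))) ≤
      P {ω | y * Real.sqrt m ≤ ∑ k ∈ Finset.range m, V k ω} := by
  obtain ⟨y, hy, hlt⟩ := exists_exp_lt_gaussianReal_Ioi hε
  refine ⟨y, hy, ?_⟩
  have hlaw : HasLaw id (gaussianReal 0 1) (gaussianReal 0 1) := HasLaw.id
  have hclt := tendstoInDistribution_inv_sqrt_mul_sum hlaw h0 h1 hV hid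
  have h := ProbabilityMeasure.le_liminf_measure_open_of_tendsto hclt.tendsto
    (isOpen_Ioi (a := y))
  have h2 := eventually_lt_of_lt_liminf (lt_of_lt_of_le
    (by simpa only [ProbabilityMeasure.coe_mk, Measure.map_id] using hlt) h)
  filter_upwards [h2, eventually_gt_atTop 0] with m hm hm0
  refine hm.le.trans ?_
  have hm0' : (0 : ℝ) < Real.sqrt m := Real.sqrt_pos.2 (by exact_mod_cast hm0)
  simp only [ProbabilityMeasure.coe_mk]
  rw [Measure.map_apply_of_aemeasurable (hclt.forall_aemeasurable m) measurableSet_Ioi]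
  refine measure_mono fun ω hω => ?_
  have hω' : y < (Real.sqrt m)⁻¹ * ∑ k ∈ Finset.range m, V k ω := hω
  rw [inv_mul_eq_div, lt_div_iff₀ hm0'] at hω'
  exact hω'.le

theorem iIndepSet_sum_ge {Ω : Type*} [MeasurableSpace Ω] {P : Measure Ω} [IsProbabilityMeasure P]
    {V : ℕ → Ω → ℝ} (hVm : ∀ k, Measurable (V k)) (hV : iIndepFun V P) {S : ℕ → Finset ℕ}
    (hS : Pairwise fun i j => Disjoint (S i) (S j)) (r : ℕ → ℝ) :
    iIndepSet (fun j => {ω | r j ≤ ∑ k ∈ S j, V k ω}) P := by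
  classical
  have hm : ∀ j, MeasurableSet {ω | r j ≤ ∑ k ∈ S j, V k ω} := fun j =>
    measurableSet_le measurable_const (Finset.measurable_sum _ fun k _ => hVm k)
  rw [iIndepSet_iff_meas_biInter hm]
  intro t
  induction t using Finset.induction_on with
  | empty => simp
  | insert j t hj ih =>
    rw [Finset.set_biInter_insert, Finset.prod_insert hj, ← ih]
    have hdis : Disjoint (↑(S j) : Set ℕ) (↑(t.biUnion S) : Set ℕ) := by
      rw [Finset.disjoint_coe, Finset.disjoint_biUnion_right]
      exact fun i hi => hS (by rintro rfl; exact hj hi)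
    have hind := indep_iSup_of_disjoint (fun k => (hVm k).comap_le) hV hdis
    refine (Indep_iff _ _ _).1 hind _ _ ?_ ?_
    · exact measurableSet_iSup_comap_sum_ge (fun k hk => hk) _
    · refine Finset.measurableSet_biInter _ fun i hi => ?_
      exact measurableSet_iSup_comap_sum_ge (fun k hk => Finset.mem_coe.2
          (Finset.mem_biUnion.2 ⟨i, hi, hk⟩)) _

theorem measure_sum_shift_ge {Ω : Type*} [MeasurableSpace Ω] {P : Measure Ω}
    {V : ℕ → Ω → ℝ} (hV : iIndepFun V P) (hid : ∀ k, IdentDistrib (V k) (V 0) P P)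
    (a m : ℕ) (s : ℝ) :
    P {ω | s ≤ ∑ k ∈ Finset.range m, V (a + k) ω} = P {ω | s ≤ ∑ k ∈ Finset.range m, V k ω} := by
  have h : IdentDistrib (fun ω k => V (a + k) ω) (fun ω k => V k ω) P P :=
    IdentDistrib.pi (fun k => (hid _).trans (hid k).symm)
      (hV.precomp (add_right_injective a)) hV
  exact (h.comp (u := fun x : ℕ → ℝ => ∑ k ∈ Finset.range m, x k)
    (by fun_prop)).measure_mem_eq (s := Set.Ici s) measurableSet_Ici

/-- If q consecutive independent blocks of length m each have sum at least s, the whole sum is at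
least q s. This turns a bound at the scale of the central limit theorem into one at a
moderate-deviation scale. -/
theorem pow_measure_sum_ge_le {Ω : Type*} [MeasurableSpace Ω] {P : Measure Ω} [IsProbabilityMeasure P]
    {V : ℕ → Ω → ℝ} (hVm : ∀ k, Measurable (V k)) (hV : iIndepFun V P)
    (hid : ∀ k, IdentDistrib (V k) (V 0) P P) (m q : ℕ) (s : ℝ) :
    P {ω | s ≤ ∑ k ∈ Finset.range m, V k ω} ^ q ≤
      P {ω | q * s ≤ ∑ k ∈ Finset.range (q * m), V k ω} := by
  induction q with
  | zero => simp
  | succ q ih =>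
    have hdis : Disjoint (↑(Finset.range (q * m)) : Set ℕ) (Set.Ici (q * m)) := by
      rw [Set.disjoint_left]; intro k hk; simpa using hk
    have hind := indep_iSup_of_disjoint (fun k => (hVm k).comap_le) hV hdis
    have hm1 : MeasurableSet[⨆ k ∈ (↑(Finset.range (q * m)) : Set ℕ),
        MeasurableSpace.comap (V k) inferInstance]
        {ω | q * s ≤ ∑ k ∈ Finset.range (q * m), V k ω} :=
      measurableSet_iSup_comap_sum_ge (fun k hk => hk) _
    have hm2 : MeasurableSet[⨆ k ∈ Set.Ici (q * m), MeasurableSpace.comap (V k) inferInstance]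
        {ω | s ≤ ∑ k ∈ Finset.range m, V (q * m + k) ω} := by
      have e : ∀ ω, ∑ k ∈ Finset.range m, V (q * m + k) ω =
          ∑ k ∈ Finset.Ico (q * m) (q * m + m), V k ω := fun ω => by
        rw [Finset.sum_Ico_eq_sum_range]; simp
      simp_rw [e]
      exact measurableSet_iSup_comap_sum_ge (fun k hk => (Finset.mem_Ico.1 hk).1) _
    calc P {ω | s ≤ ∑ k ∈ Finset.range m, V k ω} ^ (q + 1)
        ≤ P {ω | q * s ≤ ∑ k ∈ Finset.range (q * m), V k ω} *
          P {ω | s ≤ ∑ k ∈ Finset.range m, V (q * m + k) ω} := by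
          rw [pow_succ, measure_sum_shift_ge hV hid]; gcongr
      _ = P ({ω | q * s ≤ ∑ k ∈ Finset.range (q * m), V k ω} ∩
          {ω | s ≤ ∑ k ∈ Finset.range m, V (q * m + k) ω}) :=
          ((Indep_iff _ _ _).1 hind _ _ hm1 hm2).symm
      _ ≤ _ := measure_mono fun ω hω => by
          have h1 : q * s ≤ ∑ k ∈ Finset.range (q * m), V k ω := hω.1
          have h2 : s ≤ ∑ k ∈ Finset.range m, V (q * m + k) ω := hω.2
          show ((q + 1 : ℕ) : ℝ) * s ≤ _
          rw [show (q + 1) * m = q * m + m by ring, Finset.sum_range_add]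
          push_cast; linarith

open scoped Topology in
-- Put L(x) = √(x log log x). With q ~ (2κ/y²) log j blocks of length m, the right-hand side is y√(q
-- · qm), where qm ~ (1 - 1/A) A^(j+1) and log log A^(j+1) ~ log j; it is therefore asymptotic to
-- √(2κ(1 - 1/A)) L(A^(j+1)). The term with factor 2 pays for the walk up to time A^j, and L(A^j) ≤
-- √(1/A) L(A^(j+1)).
theorem eventually_mul_sqrt_log_log_pow_le {A : ℕ} (hA : 2 ≤ A) {κ c y : ℝ} (hκ : 0 < κ)
    (hy : 0 < y)
    (hA' : c + 2 * Real.sqrt (1 / A) < Real.sqrt (2 * κ * (1 - 1 / A))) :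
    ∀ᶠ j : ℕ in atTop,
      c * Real.sqrt (((A ^ (j + 1) : ℕ) : ℝ) * Real.log (Real.log ((A ^ (j + 1) : ℕ) : ℝ))) +
        2 * Real.sqrt (((A ^ j : ℕ) : ℝ) * Real.log (Real.log ((A ^ j : ℕ) : ℝ))) ≤
      ⌊2 * κ / y ^ 2 * Real.log j⌋₊ * (y * Real.sqrt
        (((A ^ (j + 1) - A ^ j) / ⌊2 * κ / y ^ 2 * Real.log j⌋₊ : ℕ) : ℝ)) := by
  set q : ℕ → ℕ := fun j => ⌊2 * κ / y ^ 2 * Real.log j⌋₊ with hq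
  set Λ : ℕ → ℝ := fun j => Real.log (Real.log ((A ^ j : ℕ) : ℝ)) with hΛ
  have hA1 : (1 : ℝ) < A := by exact_mod_cast hA
  have hA0 : (0 : ℝ) < A := by linarith
  have hlA : 0 < Real.log A := Real.log_pos hA1
  have hlogj : Tendsto (fun j : ℕ => Real.log j) atTop atTop :=
    Real.tendsto_log_atTop.comp tendsto_natCast_atTop_atTop
  have hqlog : Tendsto (fun j : ℕ => (q j : ℝ) / Real.log j) atTop (𝓝 (2 * κ / y ^ 2)) :=
    (tendsto_nat_floor_mul_div_atTop (by positivity)).comp hlogj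
  have hqtop : Tendsto q atTop atTop :=
    tendsto_nat_floor_atTop.comp (hlogj.const_mul_atTop (by positivity))
  have hΛeq : ∀ j : ℕ, 0 < j → Λ j = Real.log j + Real.log (Real.log A) := fun j hj => by
    have : (j : ℝ) ≠ 0 := by positivity
    simp only [hΛ]
    push_cast
    rw [Real.log_pow, Real.log_mul this hlA.ne']
  have hΛlog : Tendsto (fun j : ℕ => Λ (j + 1) / Real.log j) atTop (𝓝 1) := by
    have h : Tendsto (fun j : ℕ => 1 + (Real.log (j + 1) - Real.log j) / Real.log j +
        Real.log (Real.log A) / Real.log j) atTop (𝓝 (1 + 0 + 0)) :=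
      ((Real.tendsto_log_nat_add_one_sub_log.div_atTop hlogj).const_add 1).add
        (hlogj.const_div_atTop _)
    rw [add_zero, add_zero] at h
    refine h.congr' ?_
    filter_upwards [hlogj.eventually_gt_atTop 0] with j hj
    rw [hΛeq _ (Nat.succ_pos j)]
    push_cast
    field_simp
    ring
  have hqA : Tendsto (fun j : ℕ => (q j : ℝ) / (A : ℝ) ^ (j + 1)) atTop (𝓝 0) := by
    have h1 : Tendsto (fun j : ℕ => (2 * κ / y ^ 2) * ((j : ℝ) ^ 1 / (A : ℝ) ^ j)) atTop
        (𝓝 (2 * κ / y ^ 2 * 0)) :=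
      (tendsto_pow_const_div_const_pow_of_one_lt 1 hA1).const_mul _
    rw [mul_zero] at h1
    refine squeeze_zero' (Eventually.of_forall fun j => by positivity) ?_ h1
    filter_upwards [eventually_gt_atTop 0] with j hj
    have hj1 : (1 : ℝ) ≤ j := by exact_mod_cast hj
    have hl0 : 0 ≤ Real.log j := Real.log_nonneg hj1
    have e1 : (q j : ℝ) ≤ 2 * κ / y ^ 2 * j := (Nat.floor_le (by positivity)).trans
      (mul_le_mul_of_nonneg_left (Real.log_le_self (by positivity)) (by positivity))
    rw [pow_one, mul_div_assoc']
    exact div_le_div₀ (by positivity) e1 (by positivity)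
      (pow_le_pow_right₀ hA1.le (Nat.le_succ j))
  -- the square of the right-hand side, normalised
  have hmain : Tendsto (fun j : ℕ => y ^ 2 * ((q j : ℝ) / Real.log j) / (Λ (j + 1) / Real.log j) *
      (1 - 1 / A - (q j : ℝ) / (A : ℝ) ^ (j + 1))) atTop (𝓝 (2 * κ * (1 - 1 / A))) := by
    have h := (((hqlog.const_mul (y ^ 2)).div hΛlog one_ne_zero).mul
      (hqA.const_sub (1 - 1 / (A : ℝ))))
    have e : y ^ 2 * (2 * κ / y ^ 2) / 1 * (1 - 1 / (A : ℝ) - 0) = 2 * κ * (1 - 1 / A) := by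
      field_simp
      simp
    rw [e] at h
    exact h
  have hΛtop : Tendsto (fun j : ℕ => Λ j) atTop atTop := by
    have h : Tendsto (fun j : ℕ => Real.log j + Real.log (Real.log A)) atTop atTop :=
      tendsto_atTop_add_const_right _ _ hlogj
    refine h.congr' ?_
    filter_upwards [eventually_gt_atTop 0] with j hj
    rw [hΛeq j hj]
  filter_upwards [hmain.sqrt.eventually_const_lt hA', hlogj.eventually_gt_atTop 0,
    hΛtop.eventually_gt_atTop 0, (tendsto_add_atTop_nat 1).eventually
      (hΛtop.eventually_gt_atTop 0), hqtop.eventually_gt_atTop 0, eventually_gt_atTop 0]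
    with j h1 h2 h3 h4 h5 h6
  set L := Real.sqrt (((A ^ (j + 1) : ℕ) : ℝ) * Λ (j + 1)) with hL
  have hLpos : 0 ≤ L := Real.sqrt_nonneg _
  have hsmall : Real.sqrt (((A ^ j : ℕ) : ℝ) * Λ j) ≤ Real.sqrt (1 / A) * L := by
    rw [hL, ← Real.sqrt_mul (by positivity)]
    refine Real.sqrt_le_sqrt ?_
    have hmono : Λ j ≤ Λ (j + 1) := by
      rw [hΛeq j h6, hΛeq _ (Nat.succ_pos j)]
      have : Real.log j ≤ Real.log ((j + 1 : ℕ) : ℝ) :=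
        Real.log_le_log (by positivity) (by push_cast; linarith)
      linarith
    have e : 1 / (A : ℝ) * (((A ^ (j + 1) : ℕ) : ℝ) * Λ (j + 1)) = ((A ^ j : ℕ) : ℝ) * Λ (j + 1) := by
      push_cast; rw [pow_succ]; field_simp
    rw [e]
    exact mul_le_mul_of_nonneg_left hmono (by positivity)
  have hbig : Real.sqrt (y ^ 2 * ((q j : ℝ) / Real.log j) / (Λ (j + 1) / Real.log j) *
      (1 - 1 / A - (q j : ℝ) / (A : ℝ) ^ (j + 1))) * L ≤
      q j * (y * Real.sqrt (((A ^ (j + 1) - A ^ j) / q j : ℕ) : ℝ)) := by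
    have e0 : (q j : ℝ) * (y * Real.sqrt (((A ^ (j + 1) - A ^ j) / q j : ℕ) : ℝ)) =
        Real.sqrt ((q j * y) ^ 2 * (((A ^ (j + 1) - A ^ j) / q j : ℕ) : ℝ)) := by
      rw [Real.sqrt_mul (sq_nonneg _), Real.sqrt_sq (by positivity)]; ring
    rw [e0, hL, ← Real.sqrt_mul' _ (by positivity)]
    refine Real.sqrt_le_sqrt ?_
    -- Integer division loses less than one block length unit per block, hence at most q in total.
    have hdiv : ((A : ℝ) ^ (j + 1) - A ^ j) - q j ≤
        q j * (((A ^ (j + 1) - A ^ j) / q j : ℕ) : ℝ) := by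
      have hnat := Nat.lt_mul_div_succ (A ^ (j + 1) - A ^ j) h5
      have hle : A ^ j ≤ A ^ (j + 1) := Nat.pow_le_pow_right (by omega) (Nat.le_succ j)
      have hnat' : ((A ^ (j + 1) - A ^ j : ℕ) : ℝ) ≤
          q j * ((((A ^ (j + 1) - A ^ j) / q j : ℕ) : ℝ) + 1) := by exact_mod_cast hnat.le
      rw [Nat.cast_sub hle] at hnat'
      push_cast at hnat' ⊢
      linarith
    have e1 : y ^ 2 * ((q j : ℝ) / Real.log j) / (Λ (j + 1) / Real.log j) *
        (1 - 1 / A - (q j : ℝ) / (A : ℝ) ^ (j + 1)) * (((A ^ (j + 1) : ℕ) : ℝ) * Λ (j + 1)) =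
        q j * y ^ 2 * (((A : ℝ) ^ (j + 1) - A ^ j) - q j) := by
      push_cast
      rw [pow_succ]
      field_simp
      ring
    rw [e1]
    have := mul_le_mul_of_nonneg_left hdiv (show 0 ≤ (q j : ℝ) * y ^ 2 by positivity)
    linarith
  have := mul_le_mul_of_nonneg_right h1.le hLpos
  show c * L + 2 * Real.sqrt (((A ^ j : ℕ) : ℝ) * Λ j) ≤
    q j * (y * Real.sqrt (((A ^ (j + 1) - A ^ j) / q j : ℕ) : ℝ))
  linarith

open scoped Topology in
/-- Lower half of the law of the iterated logarithm for independent identically distributed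
variables with a moment of order greater than `2`. -/
theorem ae_frequently_le_sum {Ω : Type*} [MeasurableSpace Ω] {P : Measure Ω}
    [IsProbabilityMeasure P] {V : ℕ → Ω → ℝ} (hVm : ∀ k, Measurable (V k)) (hV : iIndepFun V P)
    (hid : ∀ k, IdentDistrib (V k) (V 0) P P) (hV2 : MemLp (V 0) 2 P) (h0 : ∫ ω, V 0 ω ∂P = 0)
    (h1 : ∫ ω, V 0 ω ^ 2 ∂P = 1) {γ c : ℝ} (hγ : 2 < γ)
    (hint : Integrable (fun ω => |V 0 ω| ^ γ) P) (hc0 : 0 ≤ c) (hc : c < Real.sqrt 2) :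
    ∀ᵐ ω ∂P, ∃ᶠ n : ℕ in atTop,
      c * Real.sqrt (n * Real.log (Real.log n)) ≤ ∑ k ∈ Finset.range n, V k ω := by
  have hc2 : c ^ 2 / 2 < 1 := by
    rw [Real.lt_sqrt hc0] at hc; linarith
  -- κ > c²/2 leaves room to lose 1/A of the block and the initial segment; κ < 1 leaves room for
  -- the error in the Gaussian exponent.
  obtain ⟨κ, hκc, hκ1⟩ := exists_between hc2
  have hκ0 : 0 < κ := lt_of_le_of_lt (by positivity) hκc
  have hcκ : c < Real.sqrt (2 * κ) := by rw [Real.lt_sqrt hc0]; linarith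
  obtain ⟨A, hA2, hA⟩ : ∃ A : ℕ, 2 ≤ A ∧
      c + 2 * Real.sqrt (1 / A) < Real.sqrt (2 * κ * (1 - 1 / A)) := by
    have hinv : Tendsto (fun A : ℕ => 1 / (A : ℝ)) atTop (𝓝 0) := tendsto_one_div_atTop_nhds_zero_nat
    have hl : Tendsto (fun A : ℕ => c + 2 * Real.sqrt (1 / (A : ℝ))) atTop (𝓝 (c + 2 * Real.sqrt 0)) :=
      (hinv.sqrt.const_mul 2).const_add c
    have hr : Tendsto (fun A : ℕ => Real.sqrt (2 * κ * (1 - 1 / (A : ℝ)))) atTop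
        (𝓝 (Real.sqrt (2 * κ * (1 - 0)))) := ((hinv.const_sub 1).const_mul _).sqrt
    rw [Real.sqrt_zero, mul_zero, add_zero] at hl
    rw [sub_zero, mul_one] at hr
    obtain ⟨A, hA, hA2⟩ := ((hl.eventually_lt hr hcκ).and (eventually_ge_atTop 2)).exists
    exact ⟨A, hA2, hA⟩
  -- With 1 + ε = 1/κ, the q-th power of the one-block bound has exponent -q y²/(2κ) ≥ -log j, so
  -- the j-th event has probability at least 1/j.
  have hε : 0 < 1 / κ - 1 := by rw [sub_pos, lt_div_iff₀ hκ0]; linarith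
  obtain ⟨y, hy, hclt⟩ := exists_exp_le_measure_sum_ge hV hid h0 h1 hε
  set q : ℕ → ℕ := fun j => ⌊2 * κ / y ^ 2 * Real.log j⌋₊ with hq
  set m : ℕ → ℕ := fun j => (A ^ (j + 1) - A ^ j) / q j with hm
  have hA1 : (1 : ℝ) < A := by exact_mod_cast hA2
  have hlogj : Tendsto (fun j : ℕ => Real.log j) atTop atTop :=
    Real.tendsto_log_atTop.comp tendsto_natCast_atTop_atTop
  have hle : ∀ j, A ^ j + q j * m j ≤ A ^ (j + 1) := fun j => by
    have h1 := Nat.mul_div_le (A ^ (j + 1) - A ^ j) (q j)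
    have h2 : A ^ j ≤ A ^ (j + 1) := Nat.pow_le_pow_right (by omega) (Nat.le_succ j)
    simp only [hm]; omega
  set S : ℕ → Finset ℕ := fun j => Finset.Ico (A ^ j) (A ^ j + q j * m j) with hS
  have hSlt : ∀ i j, i < j → Disjoint (S i) (S j) := fun i j hij => by
    rw [Finset.disjoint_left]
    intro k hk hk'
    have e1 := (Finset.mem_Ico.1 hk).2
    have e2 := (Finset.mem_Ico.1 hk').1
    have e3 : A ^ (i + 1) ≤ A ^ j := Nat.pow_le_pow_right (by omega) hij
    have := hle i
    omega
  have hSdis : Pairwise fun i j => Disjoint (S i) (S j) := fun i j hij => by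
    rcases lt_or_gt_of_ne hij with h | h
    · exact hSlt i j h
    · exact (hSlt j i h).symm
  set r : ℕ → ℝ := fun j => q j * (y * Real.sqrt (m j)) with hr
  have hind := iIndepSet_sum_ge hVm hV hSdis r
  -- The central limit bound needs long blocks: q grows only like log j, while the range to be
  -- divided has length at least A^j.
  have hmtop : Tendsto m atTop atTop := by
    have h1 : Tendsto (fun j : ℕ => (2 * κ / y ^ 2) * ((j : ℝ) ^ 1 / (A : ℝ) ^ j)) atTop
        (𝓝 (2 * κ / y ^ 2 * 0)) :=
      (tendsto_pow_const_div_const_pow_of_one_lt 1 hA1).const_mul _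
    rw [mul_zero] at h1
    refine tendsto_atTop.2 fun b => ?_
    filter_upwards [h1.eventually_lt_const (show (0 : ℝ) < 1 / (b + 1) by positivity),
      eventually_gt_atTop 0, (hlogj.const_mul_atTop (show 0 < 2 * κ / y ^ 2 by positivity)
        |>.eventually_ge_atTop 1)] with j hj hj0 hj1
    have hq0 : 0 < q j := Nat.floor_pos.2 hj1
    refine (Nat.le_div_iff_mul_le hq0).2 ?_
    have hj1' : (1 : ℝ) ≤ j := by exact_mod_cast hj0
    have hl0 : 0 ≤ Real.log j := Real.log_nonneg hj1'
    have e1 : (q j : ℝ) ≤ 2 * κ / y ^ 2 * j := (Nat.floor_le (by positivity)).trans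
      (mul_le_mul_of_nonneg_left (Real.log_le_self (by positivity)) (by positivity))
    have e2 : (b : ℝ) * q j ≤ (A : ℝ) ^ j := by
      rw [pow_one, mul_div_assoc', div_lt_div_iff₀ (by positivity) (by positivity), one_mul] at hj
      have : (0 : ℝ) ≤ q j := by positivity
      nlinarith
    have e3 : b * q j ≤ A ^ j := by exact_mod_cast e2
    have e4 : 2 * A ^ j ≤ A ^ (j + 1) := by rw [pow_succ']; exact Nat.mul_le_mul_right _ hA2
    omega
  have hprob : ∀ᶠ j : ℕ in atTop, ENNReal.ofReal (1 / j) ≤ P {ω | r j ≤ ∑ k ∈ S j, V k ω} := by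
    filter_upwards [hmtop.eventually hclt, eventually_gt_atTop 0] with j hj hj0
    have hj' : (0 : ℝ) < j := by exact_mod_cast hj0
    have hl0 : 0 ≤ Real.log j := Real.log_nonneg (by exact_mod_cast hj0)
    have e : P {ω | r j ≤ ∑ k ∈ S j, V k ω} =
        P {ω | r j ≤ ∑ k ∈ Finset.range (q j * m j), V k ω} := by
      rw [← measure_sum_shift_ge hV hid (A ^ j)]
      simp only [hS, Finset.sum_Ico_eq_sum_range, Nat.add_sub_cancel_left]
    rw [e]
    refine le_trans ?_ (pow_measure_sum_ge_le hVm hV hid (m j) (q j) _)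
    refine le_trans ?_ (pow_le_pow_left' hj (q j))
    rw [← ENNReal.ofReal_pow (Real.exp_pos _).le, ← Real.exp_nat_mul]
    refine ENNReal.ofReal_le_ofReal ?_
    rw [one_div, ← Real.exp_log hj', ← Real.exp_neg]
    refine Real.exp_le_exp.2 ?_
    have hqle : (q j : ℝ) ≤ 2 * κ / y ^ 2 * Real.log j := Nat.floor_le (by positivity)
    have e2 := mul_le_mul_of_nonneg_right hqle (show 0 ≤ 1 / κ * (y ^ 2 / 2) by positivity)
    have e3 : 2 * κ / y ^ 2 * Real.log j * (1 / κ * (y ^ 2 / 2)) = Real.log j := by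
      field_simp
    have e4 : (q j : ℝ) * (-(1 + (1 / κ - 1)) * (y ^ 2 / 2)) =
        -((q j : ℝ) * (1 / κ * (y ^ 2 / 2))) := by ring
    linarith
  have hsum : ∑' j, P {ω | r j ≤ ∑ k ∈ S j, V k ω} = ∞ := by
    by_contra hne
    obtain ⟨N, hN⟩ := eventually_atTop.1 hprob
    have hsum' := ENNReal.summable_toReal hne
    refine Real.not_summable_one_div_natCast ((summable_nat_add_iff N).1 ?_)
    refine Summable.of_nonneg_of_le (fun j => by positivity) (fun j => ?_)
      ((summable_nat_add_iff N).2 hsum')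
    have := ENNReal.toReal_mono (measure_ne_top _ _) (hN (j + N) (by omega))
    rwa [ENNReal.toReal_ofReal (by positivity)] at this
  have hEm : ∀ j, MeasurableSet {ω | r j ≤ ∑ k ∈ S j, V k ω} := fun j =>
    measurableSet_le measurable_const (Finset.measurable_sum _ fun k _ => hVm k)
  have hlim := measure_limsup_eq_one hEm hind hsum
  have hae : ∀ᵐ ω ∂P, ∃ᶠ j in atTop, r j ≤ ∑ k ∈ S j, V k ω := by
    have h := (mem_ae_iff_prob_eq_one (MeasurableSet.measurableSet_limsup hEm)).2 hlim
    filter_upwards [h] with ω hω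
    exact mem_limsup_iff_frequently_mem.1 hω
  -- The initial segment up to A^j could be very negative; the upper half applied to -V, with 2 >
  -- √2, bounds it.
  have hneg := ae_eventually_sum_le (V := fun k ω => -V k ω) (fun k => (hVm k).neg)
    (hV.comp (fun _ x => -x) fun _ => measurable_neg)
    (fun k => (hid k).comp (u := fun x : ℝ => -x) measurable_neg) hV2.neg
    (by rw [integral_neg, h0, neg_zero]) (by simpa using h1) hγ (by simpa using hint)
    (c := 2) (by rw [Real.sqrt_lt' (by norm_num)]; norm_num)
  have hpowtop : Tendsto (fun j => A ^ j) atTop atTop :=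
    tendsto_pow_atTop_atTop_of_one_lt (by omega)
  filter_upwards [hae, hneg] with ω hω hωn
  have hdet := eventually_mul_sqrt_log_log_pow_le hA2 hκ0 hy hA
  have hlog1 : ∀ᶠ j : ℕ in atTop, 1 ≤ Real.log ((A ^ j : ℕ) : ℝ) :=
    (hlogj.comp hpowtop).eventually_ge_atTop 1
  have hfreq := hω.and_eventually ((hpowtop.eventually hωn).and (hdet.and hlog1))
  have htop : Tendsto (fun j => A ^ j + q j * m j) atTop atTop :=
    tendsto_atTop_mono (fun j => Nat.le_add_right _ _) hpowtop
  refine htop.frequently (hfreq.mono ?_)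
  rintro j ⟨e1, e2, e3, e4⟩
  rw [← Finset.sum_range_add_sum_Ico _ (Nat.le_add_right (A ^ j) (q j * m j))]
  rw [Finset.sum_neg_distrib] at e2
  have hL : Real.sqrt (((A ^ j + q j * m j : ℕ) : ℝ) *
      Real.log (Real.log ((A ^ j + q j * m j : ℕ) : ℝ))) ≤
      Real.sqrt (((A ^ (j + 1) : ℕ) : ℝ) * Real.log (Real.log ((A ^ (j + 1) : ℕ) : ℝ))) := by
    refine Real.sqrt_le_sqrt ?_
    have hx0 : (0 : ℝ) < ((A ^ j : ℕ) : ℝ) := by positivity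
    have a1 : ((A ^ j : ℕ) : ℝ) ≤ ((A ^ j + q j * m j : ℕ) : ℝ) := by
      exact_mod_cast Nat.le_add_right _ _
    have a2 : ((A ^ j + q j * m j : ℕ) : ℝ) ≤ ((A ^ (j + 1) : ℕ) : ℝ) := by exact_mod_cast hle j
    have b1 := Real.log_le_log hx0 a1
    have b2 := Real.log_le_log (hx0.trans_le a1) a2
    have b3 := Real.log_le_log (by linarith) b2
    exact mul_le_mul a2 b3 (Real.log_nonneg (by linarith)) (by positivity)
  have := mul_le_mul_of_nonneg_left hL hc0
  have e1' : r j ≤ ∑ k ∈ Finset.Ico (A ^ j) (A ^ j + q j * m j), V k ω := e1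
  linarith

/-! ### Law of the iterated logarithm for perturbed random walks -/

open scoped Topology in
theorem limsup_div_eq_sqrt_two_mul {S R L : ℕ → ℝ} {σ : ℝ} (hσ : 0 < σ)
    (hL : ∀ᶠ n in atTop, 0 < L n)
    (hu : ∀ k : ℕ, ∀ᶠ n in atTop, S n ≤ (Real.sqrt 2 + 1 / (k + 1 : ℝ)) * L n)
    (hl : ∀ k : ℕ, ∃ᶠ n in atTop, (Real.sqrt 2 - 1 / (k + 1 : ℝ)) * L n ≤ S n)
    (hR : Tendsto (fun n => R n / L n) atTop (𝓝 0)) :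
    limsup (fun n => (((σ * S n + R n) / L n : ℝ) : EReal)) atTop
      = ((Real.sqrt 2 * σ : ℝ) : EReal) := by
  have hk0 : Tendsto (fun k : ℕ => 1 / (k + 1 : ℝ)) atTop (𝓝 0) :=
    tendsto_one_div_add_atTop_nhds_zero_nat
  refine le_antisymm ?_ ?_
  · have ht : Tendsto (fun k : ℕ => ((σ * (Real.sqrt 2 + 1 / (k + 1 : ℝ)) + 1 / (k + 1 : ℝ) : ℝ) :
        EReal)) atTop (𝓝 ((Real.sqrt 2 * σ : ℝ) : EReal)) := by
      refine (continuous_coe_real_ereal.tendsto _).comp ?_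
      have h := ((hk0.const_add (Real.sqrt 2)).const_mul σ).add hk0
      rwa [add_zero, add_zero, mul_comm] at h
    refine ge_of_tendsto' ht fun k => limsup_le_of_le (by isBoundedDefault) ?_
    filter_upwards [hL, hu k, hR.eventually_lt_const (show 0 < 1 / (k + 1 : ℝ) by positivity)]
      with n h1 h2 h3
    rw [EReal.coe_le_coe_iff, add_div]
    refine add_le_add ?_ h3.le
    rw [div_le_iff₀ h1, mul_assoc]
    exact mul_le_mul_of_nonneg_left h2 hσ.le
  · have ht : Tendsto (fun k : ℕ => ((σ * (Real.sqrt 2 - 1 / (k + 1 : ℝ)) - 1 / (k + 1 : ℝ) : ℝ) :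
        EReal)) atTop (𝓝 ((Real.sqrt 2 * σ : ℝ) : EReal)) := by
      refine (continuous_coe_real_ereal.tendsto _).comp ?_
      have h := ((hk0.const_sub (Real.sqrt 2)).const_mul σ).sub hk0
      rwa [sub_zero, sub_zero, mul_comm] at h
    refine le_of_tendsto' ht fun k => le_limsup_of_frequently_le ?_ (by isBoundedDefault)
    refine ((hl k).and_eventually (hL.and (hR.eventually_const_lt
      (show -(1 / (k + 1 : ℝ)) < 0 by simp; positivity)))).mono ?_
    rintro n ⟨h2, h1, h3⟩
    rw [EReal.coe_le_coe_iff, add_div, sub_eq_add_neg]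
    refine add_le_add ?_ h3.le
    rw [le_div_iff₀ h1, mul_assoc]
    exact mul_le_mul_of_nonneg_left h2 hσ.le

open scoped Topology in
/-- A law of the iterated logarithm for perturbed random walks: the increments are independent and
identically distributed with a moment of order greater than `2`, and the perturbation is
negligible. -/
theorem ae_limsup_liminf_perturbed_sum {Ω : Type*} [MeasurableSpace Ω] {P : Measure Ω}
    [IsProbabilityMeasure P] {U : ℕ → Ω → ℝ} (hUm : ∀ k, Measurable (U k)) (hU : iIndepFun U P)
    (hid : ∀ k, IdentDistrib (U k) (U 0) P P) {γ μ σ : ℝ} (hγ : 2 < γ)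
    (hmom : MemLp (U 0) (ENNReal.ofReal γ) P) (hμ : ∫ ω, U 0 ω ∂P = μ) (hσ : 0 < σ)
    (hvar : ∫ ω, (U 0 ω - μ) ^ 2 ∂P = σ ^ 2) {T : ℕ → Ω → ℝ}
    (hT : ∀ᵐ ω ∂P, Tendsto (fun n : ℕ => (T n ω - ∑ k ∈ Finset.range n, U k ω) /
      Real.sqrt (n * Real.log (Real.log n))) atTop (𝓝 0)) :
    (∀ᵐ ω ∂P, limsup (fun n : ℕ => (((T n ω - n * μ) /
        Real.sqrt (n * Real.log (Real.log n)) : ℝ) : EReal)) atTop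
          = ((Real.sqrt 2 * σ : ℝ) : EReal)) ∧
    (∀ᵐ ω ∂P, liminf (fun n : ℕ => (((T n ω - n * μ) /
        Real.sqrt (n * Real.log (Real.log n)) : ℝ) : EReal)) atTop
          = ((-(Real.sqrt 2 * σ) : ℝ) : EReal)) := by
  have hγ0 : 0 < γ := by linarith
  set φ : ℝ → ℝ := fun x => (x - μ) / σ with hφ
  have hφm : Measurable φ := by simp only [hφ]; fun_prop
  set V : ℕ → Ω → ℝ := fun k ω => φ (U k ω) with hV
  have hVm : ∀ k, Measurable (V k) := fun k => hφm.comp (hUm k)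
  have hVind : iIndepFun V P := hU.comp (fun _ => φ) fun _ => hφm
  have hVid : ∀ k, IdentDistrib (V k) (V 0) P P := fun k => (hid k).comp hφm
  have hVmom : MemLp (V 0) (ENNReal.ofReal γ) P := by
    have h := (hmom.sub (memLp_const μ)).const_mul σ⁻¹
    refine h.congr_norm (hVm 0).aestronglyMeasurable (ae_of_all _ fun ω => ?_)
    simp [hV, hφ, div_eq_inv_mul]
  have hint : Integrable (fun ω => |V 0 ω| ^ γ) P := by
    have h := hVmom.integrable_norm_rpow (by simpa using hγ0) ENNReal.ofReal_ne_top
    simpa [ENNReal.toReal_ofReal hγ0.le] using h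
  have h2γ : (2 : ℝ≥0∞) ≤ ENNReal.ofReal γ := by
    rw [show (2 : ℝ≥0∞) = ENNReal.ofReal 2 by simp]; exact ENNReal.ofReal_le_ofReal hγ.le
  have hV2 : MemLp (V 0) 2 P := hVmom.mono_exponent h2γ
  have hUint : Integrable (U 0) P := (hmom.mono_exponent h2γ).integrable (by norm_num)
  have h0 : ∫ ω, V 0 ω ∂P = 0 := by
    simp only [hV, hφ]
    rw [integral_div, integral_sub hUint (integrable_const _), hμ]; simp
  have h1 : ∫ ω, V 0 ω ^ 2 ∂P = 1 := by
    simp only [hV, hφ, div_pow]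
    rw [integral_div, hvar]; field_simp
  set L : ℕ → ℝ := fun n => Real.sqrt (n * Real.log (Real.log n)) with hL
  have hLpos : ∀ᶠ n in atTop, 0 < L n := tendsto_sqrt_mul_log_log_atTop.eventually_gt_atTop 0
  have hs2 : 1 < Real.sqrt 2 := by rw [Real.lt_sqrt] <;> norm_num
  have hup : ∀ k : ℕ, Real.sqrt 2 < Real.sqrt 2 + 1 / (k + 1 : ℝ) := fun k => by
    have : 0 < 1 / (k + 1 : ℝ) := by positivity
    linarith
  have hlo : ∀ k : ℕ, 0 ≤ Real.sqrt 2 - 1 / (k + 1 : ℝ) := fun k => by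
    have : 1 / (k + 1 : ℝ) ≤ 1 := by
      rw [div_le_one (by positivity)]
      have : (0 : ℝ) ≤ k := Nat.cast_nonneg k
      linarith
    linarith
  have hlo' : ∀ k : ℕ, Real.sqrt 2 - 1 / (k + 1 : ℝ) < Real.sqrt 2 := fun k => by
    have : 0 < 1 / (k + 1 : ℝ) := by positivity
    linarith
  -- Stated for a general W, to be used for V and -V. The perturbation is quantified inside the
  -- almost-sure statement because it depends on ω.
  have key : ∀ W : ℕ → Ω → ℝ, (∀ k, Measurable (W k)) → iIndepFun W P →
      (∀ k, IdentDistrib (W k) (W 0) P P) → MemLp (W 0) 2 P → ∫ ω, W 0 ω ∂P = 0 →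
      ∫ ω, W 0 ω ^ 2 ∂P = 1 → Integrable (fun ω => |W 0 ω| ^ γ) P →
      ∀ᵐ ω ∂P, ∀ R : ℕ → ℝ, Tendsto (fun n => R n / L n) atTop (𝓝 0) →
        limsup (fun n => (((σ * (∑ k ∈ Finset.range n, W k ω) + R n) / L n : ℝ) : EReal)) atTop
          = ((Real.sqrt 2 * σ : ℝ) : EReal) := by
    intro W w1 w2 w3 w4 w5 w6 w7
    have hu := ae_all_iff.2 fun k : ℕ => ae_eventually_sum_le w1 w2 w3 w4 w5 w6 hγ w7 (hup k)
    have hl := ae_all_iff.2 fun k : ℕ =>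
      ae_frequently_le_sum w1 w2 w3 w4 w5 w6 hγ w7 (hlo k) (hlo' k)
    filter_upwards [hu, hl] with ω hu hl R hR
    exact limsup_div_eq_sqrt_two_mul hσ hLpos hu hl hR
  have hVsum : ∀ n ω, σ * ∑ k ∈ Finset.range n, V k ω =
      (∑ k ∈ Finset.range n, U k ω) - n * μ := fun n ω => by
    simp only [hV, hφ]
    rw [← Finset.sum_div, Finset.sum_sub_distrib]
    simp
    field_simp
  constructor
  · filter_upwards [key V hVm hVind hVid hV2 h0 h1 hint, hT] with ω h2 h3
    rw [← h2 _ h3]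
    congr 1
    funext n
    rw [hVsum]
    congr 2
    ring
  · have hneg := key (fun k ω => -V k ω) (fun k => (hVm k).neg)
      (hVind.comp (fun _ x => -x) fun _ => measurable_neg)
      (fun k => (hVid k).comp (u := fun x : ℝ => -x) measurable_neg) hV2.neg
      (by rw [integral_neg, h0, neg_zero]) (by simpa using h1) (by simpa using hint)
    filter_upwards [hneg, hT] with ω h2 h3
    have h4 := h2 (fun n => -(T n ω - ∑ k ∈ Finset.range n, U k ω)) (by
      have := h3.neg
      rw [neg_zero] at this
      refine this.congr fun n => ?_
      rw [neg_div])
    have h5 : (fun n => (((σ * (∑ k ∈ Finset.range n, -V k ω) +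
        -(T n ω - ∑ k ∈ Finset.range n, U k ω)) / L n : ℝ) : EReal)) =
        -fun n : ℕ => (((T n ω - n * μ) / L n : ℝ) : EReal) := by
      funext n
      rw [Pi.neg_apply, ← EReal.coe_neg, Finset.sum_neg_distrib, mul_neg, hVsum, ← neg_div]
      congr 2
      ring
    rw [h5, EReal.limsup_neg, neg_eq_iff_eq_neg, ← EReal.coe_neg] at h4
    exact h4

/-! ### Population sizes under the quenched law -/

theorem measurable_populationSize {Ω : Type*} [MeasurableSpace Ω] {X : ℕ → ℕ → Ω → ℕ} (n : ℕ)
    (hX : ∀ k < n, ∀ i, Measurable (X k i)) : Measurable (populationSize X n) := by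
  induction n with
  | zero => exact measurable_const
  | succ n ih =>
    have h : Measurable (fun q : ℕ × Ω => ∑ i ∈ Finset.range q.1, X n i q.2) :=
      measurable_from_prod_countable_right fun z =>
        Finset.measurable_sum (f := fun i ω => X n i ω) (Finset.range z)
          fun i _ => hX n (Nat.lt_succ_self n) i
    exact h.comp ((ih fun k hk => hX k (hk.trans (Nat.lt_succ_self n))).prodMk measurable_id)

/-- The population sizes as functions of the array of offspring numbers. -/
def arrayPopulation (n : ℕ) (x : ℕ × ℕ → ℕ) : ℕ :=
  populationSize (fun k i (x : ℕ × ℕ → ℕ) => x (k, i)) n x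

theorem populationSize_eq_arrayPopulation {Ω : Type*} (X : ℕ → ℕ → Ω → ℕ) (n : ℕ) (ω : Ω) :
    populationSize X n ω = arrayPopulation n fun q => X q.1 q.2 ω := by
  induction n with
  | zero => rfl
  | succ n ih =>
    simp only [populationSize, arrayPopulation] at ih ⊢
    rw [ih]

theorem measurable_arrayPopulation (n : ℕ) : Measurable (arrayPopulation n) :=
  measurable_populationSize n fun _ _ _ => measurable_pi_apply _

section Quenched

variable {Θ : Type*} [MeasurableSpace Θ] (p : Kernel Θ ℕ) [IsMarkovKernel p]

/-- Generation n is a function of the rows k < n of the array only, and the rows are independent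
once the environment is fixed. -/
theorem indepFun_arrayPopulation_row (e : ℕ → Θ) (n : ℕ) :
    IndepFun (arrayPopulation n) (fun x i => x (n, i)) (quenchedLaw p e) := by
  have hind : iIndepFun (fun (q : ℕ × ℕ) (x : ℕ × ℕ → ℕ) => x q) (quenchedLaw p e) :=
    iIndepFun_infinitePi (P := fun q : ℕ × ℕ => p (e q.1)) (X := fun _ a => a)
      fun _ => measurable_id
  have hdis : Disjoint {q : ℕ × ℕ | q.1 < n} {q : ℕ × ℕ | q.1 = n} := by
    rw [Set.disjoint_left]
    intro q h1 h2
    exact absurd h2 (ne_of_lt h1)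
  have h := indep_iSup_of_disjoint (fun q => (measurable_pi_apply q).comap_le) hind hdis
  rw [IndepFun_iff_Indep]
  refine indep_of_indep_of_le_left (indep_of_indep_of_le_right h ?_) ?_
  · refine Measurable.comap_le ?_
    refine @measurable_pi_lambda _ _ _ (_) _ _ fun i => ?_
    exact (comap_measurable (fun x : ℕ × ℕ → ℕ => x (n, i))).mono
      (le_iSup₂_of_le (f := fun q (_ : q ∈ {q : ℕ × ℕ | q.1 = n}) =>
        MeasurableSpace.comap (fun x : ℕ × ℕ → ℕ => x q) _) (n, i) rfl le_rfl) le_rfl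
  · refine Measurable.comap_le ?_
    refine @measurable_populationSize _ (_) _ n fun k hk i => ?_
    exact (comap_measurable (fun x : ℕ × ℕ → ℕ => x (k, i))).mono
      (le_iSup₂_of_le (f := fun q (_ : q ∈ {q : ℕ × ℕ | q.1 < n}) =>
        MeasurableSpace.comap (fun x : ℕ × ℕ → ℕ => x q) _) (k, i) hk le_rfl) le_rfl

/-- Conditioning on the size of generation `n`. -/
theorem lintegral_arrayPopulation_row (e : ℕ → Θ) (n : ℕ) {F : ℕ → (ℕ → ℕ) → ℝ≥0∞}
    (hF : ∀ z, Measurable (F z)) :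
    ∫⁻ x, F (arrayPopulation n x) (fun i => x (n, i)) ∂quenchedLaw p e =
      ∫⁻ x, ∫⁻ y, F (arrayPopulation n x) y ∂Measure.infinitePi (fun _ : ℕ => p (e n))
        ∂quenchedLaw p e := by
  have hF' : Measurable (Function.uncurry F) := measurable_from_prod_countable_right hF
  have hZ := measurable_arrayPopulation n
  have hrow : Measurable (fun (x : ℕ × ℕ → ℕ) i => x (n, i)) := by fun_prop
  have hmap : (quenchedLaw p e).map (fun x i => x (n, i)) =
      Measure.infinitePi (fun _ : ℕ => p (e n)) :=
    Measure.map_infinitePi_infinitePi_of_inj (P := fun q : ℕ × ℕ => p (e q.1))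
      (f := fun i : ℕ => (n, i)) (fun i j h => (Prod.ext_iff.1 h).2)
  calc ∫⁻ x, F (arrayPopulation n x) (fun i => x (n, i)) ∂quenchedLaw p e
      = ∫⁻ q, Function.uncurry F q
          ∂((quenchedLaw p e).map fun x => (arrayPopulation n x, fun i => x (n, i))) :=
        (lintegral_map hF' (hZ.prodMk hrow)).symm
    _ = ∫⁻ q, Function.uncurry F q ∂(((quenchedLaw p e).map (arrayPopulation n)).prod
          (Measure.infinitePi (fun _ : ℕ => p (e n)))) := by
        rw [(indepFun_arrayPopulation_row p e n).map_prod_eq_prod_map_map hZ.aemeasurable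
          hrow.aemeasurable, hmap]
    _ = ∫⁻ z, ∫⁻ y, F z y ∂Measure.infinitePi (fun _ : ℕ => p (e n))
          ∂((quenchedLaw p e).map (arrayPopulation n)) :=
        lintegral_prod _ hF'.aemeasurable
    _ = _ := lintegral_map (measurable_of_countable _) hZ

end Quenched

/-! ### Sums of independent offspring numbers with a common law -/

section IID

variable (ν : Measure ℕ) [IsProbabilityMeasure ν]

theorem lintegral_sum_infinitePi (f : ℕ → ℝ≥0∞) (z : ℕ) :
    ∫⁻ y, ∑ i ∈ Finset.range z, f (y i) ∂Measure.infinitePi (fun _ : ℕ => ν) =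
      z * ∫⁻ k, f k ∂ν := by
  have hf : Measurable f := measurable_of_countable f
  rw [lintegral_finsetSum (f := fun i (y : ℕ → ℕ) => f (y i)) _
    fun i _ => hf.comp (measurable_pi_apply i)]
  have h : ∀ i : ℕ, ∫⁻ y : ℕ → ℕ, f (y i) ∂Measure.infinitePi (fun _ : ℕ => ν) =
      ∫⁻ k, f k ∂ν := fun i => by
    rw [← lintegral_map (g := fun y : ℕ → ℕ => y i) hf (measurable_pi_apply i)]
    exact congrArg (fun m => ∫⁻ k, f k ∂m) (Measure.infinitePi_map_eval (fun _ : ℕ => ν) i)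
  simp [h]

/-- The inequality between the arithmetic and harmonic means. -/
theorem ENNReal.inv_sum_natCast_le (y : ℕ → ℕ) {z : ℕ} (hz : 0 < z) :
    ((∑ i ∈ Finset.range z, y i : ℕ) : ℝ≥0∞)⁻¹ ≤
      (z : ℝ≥0∞)⁻¹ * (z : ℝ≥0∞)⁻¹ * ∑ i ∈ Finset.range z, (y i : ℝ≥0∞)⁻¹ := by
  have hz' : (z : ℝ≥0∞)⁻¹ ≠ 0 := ENNReal.inv_ne_zero.2 (ENNReal.natCast_ne_top z)
  -- A zero summand makes the right-hand side infinite; otherwise this is Cauchy–Schwarz.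
  by_cases h0 : ∃ i ∈ Finset.range z, y i = 0
  · obtain ⟨i, hi, hyi⟩ := h0
    have : ∑ i ∈ Finset.range z, (y i : ℝ≥0∞)⁻¹ = ∞ :=
      ENNReal.sum_eq_top.2 ⟨i, hi, by simp [hyi]⟩
    rw [this, ENNReal.mul_top (mul_ne_zero hz' hz')]
    exact le_top
  · push Not at h0
    have hpos : ∀ i ∈ Finset.range z, (0 : ℝ) < y i := fun i hi => by
      exact_mod_cast Nat.pos_of_ne_zero (h0 i hi)
    have hzr : (0 : ℝ) < z := by exact_mod_cast hz
    have hsum : (0 : ℝ) < ∑ i ∈ Finset.range z, (y i : ℝ) :=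
      Finset.sum_pos hpos ⟨0, by simpa using hz⟩
    have hcs := Finset.sum_sq_le_sum_mul_sum_of_sq_le_mul (Finset.range z) (r := fun _ => (1 : ℝ))
      (f := fun i => (y i : ℝ)) (g := fun i => (y i : ℝ)⁻¹) (fun i hi => (hpos i hi).le)
      (fun i hi => (inv_pos.2 (hpos i hi)).le)
      (fun i hi => by rw [mul_inv_cancel₀ (hpos i hi).ne']; norm_num)
    simp only [Finset.sum_const, Finset.card_range, nsmul_eq_mul, mul_one] at hcs
    have hreal : (∑ i ∈ Finset.range z, (y i : ℝ))⁻¹ ≤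
        (z : ℝ)⁻¹ * (z : ℝ)⁻¹ * ∑ i ∈ Finset.range z, (y i : ℝ)⁻¹ := by
      rw [← mul_inv, ← sq, inv_mul_eq_div, inv_eq_one_div, div_le_div_iff₀ hsum (by positivity)]
      linarith
    have e1 : ∀ n : ℕ, 0 < n → (n : ℝ≥0∞)⁻¹ = ENNReal.ofReal ((n : ℝ)⁻¹) := fun n hn => by
      rw [ENNReal.ofReal_inv_of_pos (by exact_mod_cast hn), ENNReal.ofReal_natCast]
    have hs' : 0 < ∑ i ∈ Finset.range z, y i := by exact_mod_cast hsum
    rw [e1 _ hs', e1 _ hz, Finset.sum_congr rfl fun i hi => e1 _ (Nat.pos_of_ne_zero (h0 i hi)),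
      ← ENNReal.ofReal_sum_of_nonneg fun i _ => by positivity,
      ← ENNReal.ofReal_mul (by positivity), ← ENNReal.ofReal_mul (by positivity)]
    push_cast
    exact ENNReal.ofReal_le_ofReal hreal

theorem lintegral_inv_sum_infinitePi_le (z : ℕ) :
    ∫⁻ y, ((∑ i ∈ Finset.range z, y i : ℕ) : ℝ≥0∞)⁻¹ ∂Measure.infinitePi (fun _ : ℕ => ν) ≤
      (z : ℝ≥0∞)⁻¹ * ∫⁻ k, (k : ℝ≥0∞)⁻¹ ∂ν := by
  rcases Nat.eq_zero_or_pos z with rfl | hz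
  -- For z = 0 the right-hand side is ∞ times a positive number, hence infinite.
  · have h : ∫⁻ k, (k : ℝ≥0∞)⁻¹ ∂ν ≠ 0 := by
      refine ((lintegral_pos_iff_support (measurable_of_countable _)).2 ?_).ne'
      have : Function.support (fun k : ℕ => (k : ℝ≥0∞)⁻¹) = Set.univ := by
        ext k; simp
      rw [this]; simp
    rw [Nat.cast_zero, ENNReal.inv_zero, ENNReal.top_mul h]
    exact le_top
  · have hz0 : (z : ℝ≥0∞) ≠ 0 := by exact_mod_cast hz.ne'
    calc _ ≤ ∫⁻ y : ℕ → ℕ, (z : ℝ≥0∞)⁻¹ * (z : ℝ≥0∞)⁻¹ * ∑ i ∈ Finset.range z, (y i : ℝ≥0∞)⁻¹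
          ∂Measure.infinitePi (fun _ : ℕ => ν) :=
          lintegral_mono fun y => ENNReal.inv_sum_natCast_le y hz
      _ = (z : ℝ≥0∞)⁻¹ * (z : ℝ≥0∞)⁻¹ * (z * ∫⁻ k, (k : ℝ≥0∞)⁻¹ ∂ν) := by
          rw [lintegral_const_mul' _ _ (ENNReal.mul_ne_top (ENNReal.inv_ne_top.2 hz0)
            (ENNReal.inv_ne_top.2 hz0)),
            lintegral_sum_infinitePi ν fun k => (k : ℝ≥0∞)⁻¹]
      _ = _ := by
          rw [mul_assoc, ← mul_assoc (z : ℝ≥0∞)⁻¹ (z : ℝ≥0∞),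
            ENNReal.inv_mul_cancel hz0 (ENNReal.natCast_ne_top z), one_mul]

/-- Chebyshev's inequality for the lower tail of a sum of truncated variables. -/
theorem measure_sum_lt_infinitePi_le (h0 : ν {0} = 0) {K : ℕ} (hK : 1 ≤ K) {ε : ℝ} (hε : 0 < ε)
    (z : ℕ) :
    Measure.infinitePi (fun _ : ℕ => ν) {y | ((∑ i ∈ Finset.range z, y i : ℕ) : ℝ) <
        (1 - ε) * (∫ k, ((min k K : ℕ) : ℝ) ∂ν) * z} ≤
      ENNReal.ofReal (K / ε ^ 2) * (z : ℝ≥0∞)⁻¹ := by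
  rcases Nat.eq_zero_or_pos z with rfl | hz
  · simp
  set f : ℕ → ℝ := fun k => ((min k K : ℕ) : ℝ) with hf
  set a := ∫ k, f k ∂ν with ha
  set Q := Measure.infinitePi (fun _ : ℕ => ν) with hQ
  have hfm : Measurable f := measurable_of_countable f
  have hf0 : ∀ k, 0 ≤ f k := fun k => Nat.cast_nonneg _
  have hfK : ∀ k, f k ≤ K := fun k => by simp only [hf]; exact_mod_cast min_le_right k K
  have hKr : (1 : ℝ) ≤ K := by exact_mod_cast hK
  have hzr : (1 : ℝ) ≤ z := by exact_mod_cast hz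
  have hfint : Integrable f ν := Integrable.of_bound hfm.aestronglyMeasurable (C := K)
    (ae_of_all _ fun k => by rw [Real.norm_of_nonneg (hf0 k)]; exact hfK k)
  have ha1 : 1 ≤ a := by
    have h1 : ∀ᵐ k ∂ν, 1 ≤ f k := by
      have : ∀ᵐ k ∂ν, k ≠ 0 := by
        rw [ae_iff]; simpa using h0
      filter_upwards [this] with k hk
      simp only [hf]
      exact_mod_cast le_min (Nat.one_le_iff_ne_zero.2 hk) hK
    have := integral_mono_ae (integrable_const (1 : ℝ)) hfint h1
    simpa using this
  have hev : ∀ i : ℕ, Q.map (fun y => y i) = ν := fun i =>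
    Measure.infinitePi_map_eval (fun _ : ℕ => ν) i
  set Y : ℕ → (ℕ → ℕ) → ℝ := fun i y => f (y i) with hY
  have hYm : ∀ i, Measurable (Y i) := fun i => hfm.comp (measurable_pi_apply i)
  have hYmem : ∀ i, MemLp (Y i) 2 Q := fun i => MemLp.of_bound (hYm i).aestronglyMeasurable K
    (ae_of_all _ fun y => by rw [Real.norm_of_nonneg (hf0 _)]; exact hfK _)
  have hYmean : ∀ i, ∫ y, Y i y ∂Q = a := fun i => by
    rw [ha, ← hev i, integral_map (measurable_pi_apply i).aemeasurable hfm.aestronglyMeasurable]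
  -- Values in [0, K] give f² ≤ K f. The variance is thus linear in a, and the remaining factor 1/a
  -- is dropped at the end since a ≥ 1.
  have hYvar : ∀ i, variance (Y i) Q ≤ K * a := fun i => by
    refine (variance_le_expectation_sq (hYm i).aestronglyMeasurable).trans ?_
    rw [← hYmean i, ← integral_const_mul]
    refine integral_mono_of_nonneg (ae_of_all _ fun y => sq_nonneg _)
      (((hYmem i).integrable (by norm_num)).const_mul _) (ae_of_all _ fun y => ?_)
    show f (y i) ^ 2 ≤ K * f (y i)
    rw [sq]
    exact mul_le_mul_of_nonneg_right (hfK _) (hf0 _)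
  have hind : iIndepFun Y Q :=
    iIndepFun_infinitePi (P := fun _ : ℕ => ν) (X := fun _ => f) fun _ => hfm
  set S : (ℕ → ℕ) → ℝ := ∑ i ∈ Finset.range z, Y i with hS
  have hSmem : MemLp S 2 Q := memLp_finsetSum' _ fun i _ => hYmem i
  have hSmean : ∫ y, S y ∂Q = z * a := by
    simp only [hS, Finset.sum_apply]
    rw [integral_finsetSum _ fun i _ => (hYmem i).integrable (by norm_num)]
    simp [hYmean]
  have hSvar : variance S Q ≤ z * (K * a) := by
    rw [hS, IndepFun.variance_sum (fun i _ => hYmem i) fun i _ j _ hij => hind.indepFun hij]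
    refine (Finset.sum_le_sum fun i _ => hYvar i).trans ?_
    simp
  have hc : 0 < ε * a * z := by positivity
  have hsub : {y : ℕ → ℕ | ((∑ i ∈ Finset.range z, y i : ℕ) : ℝ) < (1 - ε) * a * z} ⊆
      {y | ε * a * z ≤ |S y - ∫ y, S y ∂Q|} := fun y hy => by
    have hy' : ((∑ i ∈ Finset.range z, y i : ℕ) : ℝ) < (1 - ε) * a * z := hy
    have hle : S y ≤ ((∑ i ∈ Finset.range z, y i : ℕ) : ℝ) := by
      simp only [hS, Finset.sum_apply, hY, hf]
      push_cast
      exact Finset.sum_le_sum fun i _ => min_le_left _ _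
    show ε * a * z ≤ |S y - ∫ y, S y ∂Q|
    rw [hSmean]
    refine le_trans ?_ (neg_le_abs _)
    linarith
  refine (measure_mono hsub).trans ((meas_ge_le_variance_div_sq hSmem hc).trans ?_)
  rw [show (z : ℝ≥0∞)⁻¹ = ENNReal.ofReal ((z : ℝ)⁻¹) by
    rw [ENNReal.ofReal_inv_of_pos (by linarith), ENNReal.ofReal_natCast],
    ← ENNReal.ofReal_mul (by positivity)]
  refine ENNReal.ofReal_le_ofReal ?_
  calc variance S Q / (ε * a * z) ^ 2 ≤ z * (K * a) / (ε * a * z) ^ 2 := by gcongr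
    _ = K / ε ^ 2 * (z : ℝ)⁻¹ * a⁻¹ := by field_simp
    _ ≤ K / ε ^ 2 * (z : ℝ)⁻¹ * 1 :=
        mul_le_mul_of_nonneg_left (inv_le_one_of_one_le₀ ha1) (by positivity)
    _ = _ := mul_one _

end IID

/-! ### Quenched moments and one-generation growth -/

section QuenchedMoments

variable {Θ : Type*} [MeasurableSpace Θ] (p : Kernel Θ ℕ) [IsMarkovKernel p]

theorem arrayPopulation_succ (n : ℕ) (x : ℕ × ℕ → ℕ) :
    arrayPopulation (n + 1) x = ∑ i ∈ Finset.range (arrayPopulation n x), x (n, i) := rfl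

theorem measurable_comp_arrayPopulation {β : Type*} [MeasurableSpace β] (n : ℕ) (f : ℕ → β) :
    Measurable fun x => f (arrayPopulation n x) :=
  (measurable_of_countable f).comp (measurable_arrayPopulation n)

theorem measurable_sum_range_pi (z : ℕ) :
    Measurable (fun y : ℕ → ℕ => ∑ i ∈ Finset.range z, y i) :=
  Finset.measurable_sum _ fun i _ => measurable_pi_apply i

theorem offspringMean_eq_lintegral {Θ : Type*} [MeasurableSpace Θ] (p : Kernel Θ ℕ) (θ : Θ) :
    offspringMean p θ = ∫⁻ k, (k : ℝ≥0∞) ∂p θ :=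
  (lintegral_countable' _).symm

theorem lintegral_arrayPopulation (e : ℕ → Θ) (n : ℕ) :
    ∫⁻ x, (arrayPopulation n x : ℝ≥0∞) ∂quenchedLaw p e =
      ∏ k ∈ Finset.range n, offspringMean p (e k) := by
  induction n with
  | zero => simp [arrayPopulation, populationSize]
  | succ n ih =>
    simp only [arrayPopulation_succ]
    rw [lintegral_arrayPopulation_row p e n
      (F := fun z y => ((∑ i ∈ Finset.range z, y i : ℕ) : ℝ≥0∞))
      (fun z => (measurable_of_countable (fun k : ℕ => (k : ℝ≥0∞))).comp
        (measurable_sum_range_pi z)), Finset.prod_range_succ, ← ih,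
      ← lintegral_mul_const _ (measurable_comp_arrayPopulation n fun k => (k : ℝ≥0∞))]
    refine lintegral_congr fun x => ?_
    rw [offspringMean_eq_lintegral, ← lintegral_sum_infinitePi]
    push_cast
    rfl

/-- Given generation n, the arithmetic–harmonic mean inequality costs only a factor E[1/X], so the
harmonic moments are submultiplicative along the generations. -/
theorem lintegral_inv_arrayPopulation_le (e : ℕ → Θ) (n : ℕ) :
    ∫⁻ x, (arrayPopulation n x : ℝ≥0∞)⁻¹ ∂quenchedLaw p e ≤
      ∏ k ∈ Finset.range n, ∫⁻ j, (j : ℝ≥0∞)⁻¹ ∂p (e k) := by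
  induction n with
  | zero => simp [arrayPopulation, populationSize]
  | succ n ih =>
    simp only [arrayPopulation_succ]
    rw [lintegral_arrayPopulation_row p e n
      (F := fun z y => ((∑ i ∈ Finset.range z, y i : ℕ) : ℝ≥0∞)⁻¹)
      (fun z => (measurable_of_countable (fun k : ℕ => (k : ℝ≥0∞)⁻¹)).comp
        (measurable_sum_range_pi z)), Finset.prod_range_succ]
    refine le_trans ?_ (mul_le_mul_left ih _)
    rw [← lintegral_mul_const _ (measurable_comp_arrayPopulation n fun k => (k : ℝ≥0∞)⁻¹)]
    exact lintegral_mono fun x => lintegral_inv_sum_infinitePi_le _ _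

/-- Conditionally on generation n, Chebyshev gives a bound proportional to the reciprocal of its
size; integrating leaves the harmonic moment. -/
theorem quenchedLaw_arrayPopulation_succ_lt_le (e : ℕ → Θ) (n : ℕ) (h0 : p (e n) {0} = 0) {K : ℕ}
    (hK : 1 ≤ K) {ε : ℝ} (hε : 0 < ε) :
    quenchedLaw p e {x | (arrayPopulation (n + 1) x : ℝ) <
        (1 - ε) * (∫ k, ((min k K : ℕ) : ℝ) ∂p (e n)) * arrayPopulation n x} ≤
      ENNReal.ofReal (K / ε ^ 2) * ∫⁻ x, (arrayPopulation n x : ℝ≥0∞)⁻¹ ∂quenchedLaw p e := by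
  set a := (1 - ε) * ∫ k, ((min k K : ℕ) : ℝ) ∂p (e n) with ha
  set B : ℕ → Set (ℕ → ℕ) := fun z => {y | ((∑ i ∈ Finset.range z, y i : ℕ) : ℝ) < a * z} with hB
  have hBm : ∀ z, MeasurableSet (B z) := fun z => measurableSet_lt
    ((measurable_of_countable (fun k : ℕ => (k : ℝ))).comp (measurable_sum_range_pi z))
    measurable_const
  have hm : MeasurableSet {x : ℕ × ℕ → ℕ | (arrayPopulation (n + 1) x : ℝ) <
      a * arrayPopulation n x} := measurableSet_lt
    (measurable_comp_arrayPopulation _ fun k => (k : ℝ))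
    (measurable_comp_arrayPopulation _ fun k => a * (k : ℝ))
  rw [← lintegral_indicator_one hm]
  have h := lintegral_arrayPopulation_row p e n (F := fun z => (B z).indicator 1)
    (fun z => measurable_one.indicator (hBm z))
  refine (le_of_eq h).trans ?_
  rw [← lintegral_const_mul _ (measurable_comp_arrayPopulation n fun k => (k : ℝ≥0∞)⁻¹)]
  refine lintegral_mono fun x => ?_
  rw [lintegral_indicator_one (hBm _)]
  exact measure_sum_lt_infinitePi_le _ h0 hK hε _

end QuenchedMoments

/-! ### Annealed moments and probabilities -/

theorem measurable_offspringMean {Θ : Type*} [MeasurableSpace Θ] (p : Kernel Θ ℕ) :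
    Measurable (offspringMean p) := by
  have : offspringMean p = fun θ => ∫⁻ k, (k : ℝ≥0∞) ∂p θ :=
    funext fun θ => offspringMean_eq_lintegral p θ
  rw [this]
  exact (measurable_of_countable _).lintegral_kernel

theorem integral_min_natCast_eq_toReal {ν : Measure ℕ} (K : ℕ) :
    ∫ k, ((min k K : ℕ) : ℝ) ∂ν = (∫⁻ k, ((min k K : ℕ) : ℝ≥0∞) ∂ν).toReal := by
  rw [integral_eq_lintegral_of_nonneg_ae (ae_of_all _ fun k => Nat.cast_nonneg _)
    (measurable_of_countable _).aestronglyMeasurable]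
  simp only [ENNReal.ofReal_natCast]

theorem ae_ne_zero_of_measure_singleton_zero {ν : Measure ℕ} (h : ν {0} = 0) : ∀ᵐ k ∂ν, k ≠ 0 := by
  rw [ae_iff]; simpa using h

theorem one_le_offspringMean {Θ : Type*} [MeasurableSpace Θ] (p : Kernel Θ ℕ) [IsMarkovKernel p]
    {θ : Θ} (h : p θ {0} = 0) : 1 ≤ offspringMean p θ := by
  rw [offspringMean_eq_lintegral]
  have h1 : ∀ᵐ k : ℕ ∂p θ, (1 : ℝ≥0∞) ≤ (k : ℝ≥0∞) := by
    filter_upwards [ae_ne_zero_of_measure_singleton_zero h] with k hk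
    exact_mod_cast Nat.one_le_iff_ne_zero.2 hk
  simpa using lintegral_mono_ae h1

theorem lintegral_inv_natCast_le_one {ν : Measure ℕ} [IsProbabilityMeasure ν] (h : ν {0} = 0) :
    ∫⁻ k, (k : ℝ≥0∞)⁻¹ ∂ν ≤ 1 := by
  have h1 : ∀ᵐ k : ℕ ∂ν, (k : ℝ≥0∞)⁻¹ ≤ 1 := by
    filter_upwards [ae_ne_zero_of_measure_singleton_zero h] with k hk
    exact ENNReal.inv_le_one.2 (by exact_mod_cast Nat.one_le_iff_ne_zero.2 hk)
  simpa using lintegral_mono_ae h1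

/-- Equality case: without mass at 0, the reciprocal 1/k is at most 1, with equality only at k = 1.
-/
theorem offspringMean_eq_one {Θ : Type*} [MeasurableSpace Θ] (p : Kernel Θ ℕ) [IsMarkovKernel p]
    {θ : Θ} (h : p θ {0} = 0) (h1 : 1 ≤ ∫⁻ k, (k : ℝ≥0∞)⁻¹ ∂p θ) : offspringMean p θ = 1 := by
  have hle : (fun k : ℕ => (k : ℝ≥0∞)⁻¹) ≤ᵐ[p θ] fun _ => 1 := by
    filter_upwards [ae_ne_zero_of_measure_singleton_zero h] with k hk
    exact ENNReal.inv_le_one.2 (by exact_mod_cast Nat.one_le_iff_ne_zero.2 hk)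
  have heq := ae_eq_of_ae_le_of_lintegral_le hle
    (ne_top_of_le_ne_top ENNReal.one_ne_top (lintegral_inv_natCast_le_one h))
    measurable_const.aemeasurable (by simpa using h1)
  rw [offspringMean_eq_lintegral]
  have : (fun k : ℕ => (k : ℝ≥0∞)) =ᵐ[p θ] fun _ => 1 := by
    filter_upwards [heq] with k hk
    rwa [ENNReal.inv_eq_one] at hk
  rw [lintegral_congr_ae this]; simp

section Annealed

variable {Ω Θ : Type*} [MeasurableSpace Ω] [MeasurableSpace Θ] {P : Measure Ω}
  [IsProbabilityMeasure P] {p : Kernel Θ ℕ} [IsMarkovKernel p] {ξ : ℕ → Ω → Θ}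
  {X : ℕ → ℕ → Ω → ℕ}

/-- Integration with respect to the annealed law through the quenched laws. -/
theorem IsBranchingInIIDEnvironment.lintegral_eq (hZ : IsBranchingInIIDEnvironment P p ξ X)
    {F : (ℕ → Θ) × (ℕ × ℕ → ℕ) → ℝ≥0∞} (hF : Measurable F) :
    ∫⁻ ω, F ((fun n => ξ n ω), (fun q => X q.1 q.2 ω)) ∂P =
      ∫⁻ ω, ∫⁻ x, F ((fun n => ξ n ω), x) ∂quenchedLaw p (fun n => ξ n ω) ∂P := by
  have hξ : Measurable (fun ω n => ξ n ω) := measurable_pi_lambda _ hZ.measurable_env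
  have hX : Measurable (fun ω (q : ℕ × ℕ) => X q.1 q.2 ω) :=
    measurable_pi_lambda _ fun q => hZ.measurable_offspring q.1 q.2
  have := Measure.isProbabilityMeasure_map (μ := P) hξ.aemeasurable
  rw [← lintegral_map hF (hξ.prodMk hX), hZ.joint_law, Measure.lintegral_compProd hF,
    lintegral_map (hF.lintegral_kernel_prod_right') hξ]

theorem IsBranchingInIIDEnvironment.ae_env {Ω Θ : Type*} [MeasurableSpace Ω] [MeasurableSpace Θ]
    {P : Measure Ω} {p : Kernel Θ ℕ} [IsMarkovKernel p] {ξ : ℕ → Ω → Θ} {X : ℕ → ℕ → Ω → ℕ}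
    (hZ : IsBranchingInIIDEnvironment P p ξ X)
    {s : Set Θ} (hs : MeasurableSet s) (h : ∀ᵐ ω ∂P, ξ 0 ω ∈ s) : ∀ᵐ ω ∂P, ∀ n, ξ n ω ∈ s := by
  refine ae_all_iff.2 fun n => ?_
  exact ((hZ.identDistrib_env n).symm).ae_mem_snd hs h

/-- The quenched expectation of the population is the product of the means. An inequality suffices,
and it needs no exclusion of zero or infinite means. -/
theorem IsBranchingInIIDEnvironment.lintegral_populationSize_mul_inv_le
    (hZ : IsBranchingInIIDEnvironment P p ξ X) (n : ℕ) :
    ∫⁻ ω, (populationSize X n ω : ℝ≥0∞) *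
      (∏ k ∈ Finset.range n, offspringMean p (ξ k ω))⁻¹ ∂P ≤ 1 := by
  have hM : Measurable (fun e : ℕ → Θ => ∏ k ∈ Finset.range n, offspringMean p (e k)) :=
    Finset.measurable_prod _ fun k _ => (measurable_offspringMean p).comp (measurable_pi_apply k)
  have hF : Measurable (fun w : (ℕ → Θ) × (ℕ × ℕ → ℕ) => (arrayPopulation n w.2 : ℝ≥0∞) *
      (∏ k ∈ Finset.range n, offspringMean p (w.1 k))⁻¹) :=
    ((measurable_comp_arrayPopulation n fun k => (k : ℝ≥0∞)).comp measurable_snd).mul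
      (hM.comp measurable_fst).inv
  simp only [populationSize_eq_arrayPopulation]
  rw [hZ.lintegral_eq hF]
  calc _ ≤ ∫⁻ ω, 1 ∂P := lintegral_mono fun ω => ?_
    _ = 1 := by simp
  dsimp only
  rw [lintegral_mul_const _ (measurable_comp_arrayPopulation n fun k => (k : ℝ≥0∞)),
    lintegral_arrayPopulation]
  exact ENNReal.mul_inv_le_one _

/-- The quenched bound is a product of functions of the single environments; as these are i.i.d.,
its expectation is a power. -/
theorem IsBranchingInIIDEnvironment.lintegral_inv_populationSize_le
    (hZ : IsBranchingInIIDEnvironment P p ξ X) (n : ℕ) :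
    ∫⁻ ω, (populationSize X n ω : ℝ≥0∞)⁻¹ ∂P ≤
      (∫⁻ ω, ∫⁻ k, (k : ℝ≥0∞)⁻¹ ∂p (ξ 0 ω) ∂P) ^ n := by
  have hr : Measurable (fun θ : Θ => ∫⁻ k, (k : ℝ≥0∞)⁻¹ ∂p θ) :=
    (measurable_of_countable _).lintegral_kernel
  simp only [populationSize_eq_arrayPopulation]
  rw [hZ.lintegral_eq (F := fun w => (arrayPopulation n w.2 : ℝ≥0∞)⁻¹)
    ((measurable_comp_arrayPopulation n fun k => (k : ℝ≥0∞)⁻¹).comp measurable_snd)]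
  refine (lintegral_mono fun ω => lintegral_inv_arrayPopulation_le p _ n).trans (le_of_eq ?_)
  rw [lintegral_prod_eq_prod_lintegral_of_indepFun (Finset.range n)
    (fun k ω => ∫⁻ j, (j : ℝ≥0∞)⁻¹ ∂p (ξ k ω)) (hZ.indep_env.comp (fun _ => _) fun _ => hr)
    fun k => hr.comp (hZ.measurable_env k)]
  have h : ∀ k, ∫⁻ ω, ∫⁻ j, (j : ℝ≥0∞)⁻¹ ∂p (ξ k ω) ∂P = ∫⁻ ω, ∫⁻ j, (j : ℝ≥0∞)⁻¹ ∂p (ξ 0 ω) ∂P :=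
    fun k => ((hZ.identDistrib_env k).comp hr).lintegral_eq
  simp [h]

theorem IsBranchingInIIDEnvironment.measure_populationSize_succ_lt_le
    (hZ : IsBranchingInIIDEnvironment P p ξ X) (hp0 : ∀ᵐ ω ∂P, ∀ n, p (ξ n ω) {0} = 0) (n : ℕ)
    {K : ℕ} (hK : 1 ≤ K) {ε : ℝ} (hε : 0 < ε) :
    P {ω | (populationSize X (n + 1) ω : ℝ) <
        (1 - ε) * (∫ k, ((min k K : ℕ) : ℝ) ∂p (ξ n ω)) * populationSize X n ω} ≤
      ENNReal.ofReal (K / ε ^ 2) * ∫⁻ ω, (populationSize X n ω : ℝ≥0∞)⁻¹ ∂P := by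
  have ha : Measurable (fun θ : Θ => (1 - ε) * ∫ k, ((min k K : ℕ) : ℝ) ∂p θ) := by
    simp_rw [integral_min_natCast_eq_toReal]
    exact ((measurable_of_countable _).lintegral_kernel.ennreal_toReal).const_mul _
  set B : Set ((ℕ → Θ) × (ℕ × ℕ → ℕ)) := {w | (arrayPopulation (n + 1) w.2 : ℝ) <
        (1 - ε) * (∫ k, ((min k K : ℕ) : ℝ) ∂p (w.1 n)) * arrayPopulation n w.2} with hB
  have hBm : MeasurableSet B := measurableSet_lt
    ((measurable_comp_arrayPopulation (n + 1) fun k => (k : ℝ)).comp measurable_snd)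
    ((ha.comp ((measurable_pi_apply n).comp measurable_fst)).mul
      ((measurable_comp_arrayPopulation n fun k => (k : ℝ)).comp measurable_snd))
  have hξ : Measurable (fun ω n => ξ n ω) := measurable_pi_lambda _ hZ.measurable_env
  have hX : Measurable (fun ω (q : ℕ × ℕ) => X q.1 q.2 ω) :=
    measurable_pi_lambda _ fun q => hZ.measurable_offspring q.1 q.2
  simp only [populationSize_eq_arrayPopulation]
  have hinv : Measurable (fun x => (arrayPopulation n x : ℝ≥0∞)⁻¹) :=
    measurable_comp_arrayPopulation n fun k => (k : ℝ≥0∞)⁻¹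
  rw [hZ.lintegral_eq (F := fun w => (arrayPopulation n w.2 : ℝ≥0∞)⁻¹)
    (hinv.comp measurable_snd)]
  have e1 : P {ω | ((fun n => ξ n ω), (fun q : ℕ × ℕ => X q.1 q.2 ω)) ∈ B} =
      ∫⁻ ω, quenchedLaw p (fun n => ξ n ω) {x | ((fun n => ξ n ω), x) ∈ B} ∂P := by
    have h := hZ.lintegral_eq (F := B.indicator 1) (measurable_one.indicator hBm)
    have e : ∫⁻ ω, B.indicator (1 : (ℕ → Θ) × (ℕ × ℕ → ℕ) → ℝ≥0∞) ((fun n => ξ n ω), (fun q : ℕ × ℕ => X q.1 q.2 ω)) ∂P =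
        P {ω | ((fun n => ξ n ω), (fun q : ℕ × ℕ => X q.1 q.2 ω)) ∈ B} :=
      lintegral_indicator_one ((hξ.prodMk hX) hBm)
    rw [← e, h]
    exact lintegral_congr fun ω => lintegral_indicator_one (measurable_prodMk_left hBm)
  refine (le_of_eq e1).trans ?_
  rw [← lintegral_const_mul' _ _ ENNReal.ofReal_ne_top]
  refine lintegral_mono_ae ?_
  filter_upwards [hp0] with ω hω
  exact quenchedLaw_arrayPopulation_succ_lt_le p _ n (hω n) hK hε

end Annealed

/-! ### Deterministic growth and truncation of the offspring law -/

theorem Real.neg_two_mul_le_log_one_sub {t : ℝ} (h0 : 0 ≤ t) (h1 : t ≤ 1 / 2) :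
    -(2 * t) ≤ Real.log (1 - t) := by
  have h := Real.one_sub_inv_le_log_of_pos (show 0 < 1 - t by linarith)
  refine le_trans ?_ h
  have : (1 - t)⁻¹ ≤ 1 + 2 * t := by
    rw [inv_le_iff_one_le_mul₀ (by linarith)]
    nlinarith
  linarith

/-- A sequence that almost satisfies `z (n + 1) ≥ m n * z n`, up to summable relative errors, is
bounded below by a multiple of the products of the `m n`. -/
theorem exists_log_ge_sum_log_sub {z m a η ε : ℕ → ℝ} (hz : ∀ n, 1 ≤ z n) (hm : ∀ n, 1 ≤ m n)
    (hη0 : ∀ n, 0 ≤ η n) (hη : Summable η) (hε0 : ∀ n, 0 ≤ ε n)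
    (hε : Summable ε) (ham : ∀ n, m n - a n ≤ η n * m n)
    (hza : ∀ᶠ n in atTop, (1 - ε n) * a n * z n ≤ z (n + 1)) :
    ∃ C, ∀ᶠ n in atTop, ∑ k ∈ Finset.range n, Real.log (m k) - C ≤ Real.log (z n) := by
  set g : ℕ → ℝ := fun n => 2 * η n + 2 * ε n with hg
  have hg0 : ∀ n, 0 ≤ g n := fun n => by have := hη0 n; have := hε0 n; simp only [hg]; linarith
  have hgs : Summable g := (hη.mul_left 2).add (hε.mul_left 2)
  have hstep : ∀ᶠ n in atTop, Real.log (m n) - g n ≤ Real.log (z (n + 1)) - Real.log (z n) := by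
    filter_upwards [hza, hη.tendsto_atTop_zero.eventually_le_const (show (0 : ℝ) < 1 / 2 by norm_num),
      hε.tendsto_atTop_zero.eventually_le_const (show (0 : ℝ) < 1 / 2 by norm_num)] with n h1 h2 h3
    have hmn := hm n
    have hzn := hz n
    have hη' : 0 < 1 - η n := by linarith
    have hε' : 0 < 1 - ε n := by linarith
    have han : (1 - η n) * m n ≤ a n := by have := ham n; linarith
    have h4 : (1 - ε n) * ((1 - η n) * m n) * z n ≤ z (n + 1) :=
      le_trans (by gcongr) h1
    have h5 := Real.log_le_log (by positivity) h4
    rw [Real.log_mul (by positivity) (by positivity), Real.log_mul (by positivity) (by positivity),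
      Real.log_mul (by positivity) (by positivity)] at h5
    have h6 := Real.neg_two_mul_le_log_one_sub (hη0 n) h2
    have h7 := Real.neg_two_mul_le_log_one_sub (hε0 n) h3
    simp only [hg]
    linarith
  obtain ⟨N, hN⟩ := eventually_atTop.1 hstep
  -- Before N nothing better than log z ≥ 0 is used, so the whole initial sum of log means goes into
  -- the constant.
  refine ⟨∑ k ∈ Finset.range N, Real.log (m k) + ∑' k, g k, ?_⟩
  have hind : ∀ n, N ≤ n → ∑ k ∈ Finset.range n, Real.log (m k) -
      ∑ k ∈ Finset.range N, Real.log (m k) - ∑ k ∈ Finset.range n, g k ≤ Real.log (z n) := by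
    intro n hn
    induction n, hn using Nat.le_induction with
    | base =>
      have := Finset.sum_nonneg fun k (_ : k ∈ Finset.range N) => hg0 k
      have := Real.log_nonneg (hz N)
      linarith
    | succ n hn ih =>
      rw [Finset.sum_range_succ, Finset.sum_range_succ]
      have := hN n hn
      linarith
  filter_upwards [eventually_ge_atTop N] with n hn
  have := hind n hn
  have := hgs.sum_le_tsum (Finset.range n) fun k _ => hg0 k
  linarith

/-- At most 1 + log k / log s indices n satisfy s^n < k. This count is the source of the logarithm
in the `Z log Z` condition. -/
theorem tsum_ite_ceil_pow_lt_le {s : ℝ} (hs : 1 < s) (k : ℕ) :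
    ∑' n : ℕ, (if ⌈s ^ n⌉₊ < k then (k : ℝ≥0∞) else 0) ≤
      k * ENNReal.ofReal (1 + Real.log k / Real.log s) := by
  have hls : 0 < Real.log s := Real.log_pos hs
  have hlk : 0 ≤ Real.log k := Real.log_natCast_nonneg k
  set N := ⌊Real.log k / Real.log s⌋₊ + 1 with hN
  rw [tsum_eq_sum (s := Finset.range N)]
  · calc ∑ n ∈ Finset.range N, (if ⌈s ^ n⌉₊ < k then (k : ℝ≥0∞) else 0)
        ≤ ∑ n ∈ Finset.range N, (k : ℝ≥0∞) :=
          Finset.sum_le_sum fun n _ => by split_ifs <;> simp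
      _ = k * (N : ℝ≥0∞) := by simp [mul_comm]
      _ ≤ _ := by
          refine mul_le_mul_right ?_ _
          rw [← ENNReal.ofReal_natCast]
          refine ENNReal.ofReal_le_ofReal ?_
          rw [hN]; push_cast
          have := Nat.floor_le (div_nonneg hlk hls.le)
          linarith
  · intro n hn
    rw [if_neg]
    intro hlt
    apply hn
    rw [Finset.mem_range, hN, Nat.lt_succ_iff]
    refine Nat.le_floor ?_
    rw [le_div_iff₀ hls, ← Real.log_pow]
    exact Real.log_le_log (by positivity)
      ((Nat.le_ceil _).trans (by exact_mod_cast hlt.le))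

/-- The part of the offspring mean carried by families of more than `K` members. -/
noncomputable def offspringTail {Θ : Type*} [MeasurableSpace Θ] (p : Kernel Θ ℕ) (K : ℕ) (θ : Θ) :
    ℝ≥0∞ :=
  ∫⁻ k, (if K < k then (k : ℝ≥0∞) else 0) ∂p θ

theorem measurable_offspringTail {Θ : Type*} [MeasurableSpace Θ] (p : Kernel Θ ℕ) (K : ℕ) :
    Measurable (offspringTail p K) :=
  (measurable_of_countable _).lintegral_kernel

theorem offspringMean_le_add_offspringTail {Θ : Type*} [MeasurableSpace Θ] (p : Kernel Θ ℕ)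
    (K : ℕ) (θ : Θ) :
    offspringMean p θ ≤ ∫⁻ k, ((min k K : ℕ) : ℝ≥0∞) ∂p θ + offspringTail p K θ := by
  rw [offspringMean_eq_lintegral, offspringTail, ← lintegral_add_left (measurable_of_countable _)]
  refine lintegral_mono fun k => ?_
  dsimp only
  split_ifs with h
  · exact le_add_self
  · rw [min_eq_left (not_lt.1 h), add_zero]

/-- The loss from truncation is written relative to the mean, as `exists_log_ge_sum_log_sub`
requires. -/
theorem toReal_offspringMean_sub_le {Θ : Type*} [MeasurableSpace Θ] (p : Kernel Θ ℕ)
    [IsMarkovKernel p] (K : ℕ) {θ : Θ} (h0 : p θ {0} = 0) (ht : offspringMean p θ ≠ ∞) :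
    (offspringMean p θ).toReal - ∫ k, ((min k K : ℕ) : ℝ) ∂p θ ≤
      (offspringTail p K θ * (offspringMean p θ)⁻¹).toReal * (offspringMean p θ).toReal := by
  have hm0 : offspringMean p θ ≠ 0 := (lt_of_lt_of_le one_pos (one_le_offspringMean p h0)).ne'
  have htail : offspringTail p K θ ≤ offspringMean p θ := by
    rw [offspringMean_eq_lintegral, offspringTail]
    exact lintegral_mono fun k => by dsimp only; split_ifs <;> simp
  have hmin : ∫⁻ k, ((min k K : ℕ) : ℝ≥0∞) ∂p θ ≤ offspringMean p θ := by
    rw [offspringMean_eq_lintegral]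
    exact lintegral_mono fun k => Nat.cast_le.2 (min_le_left k K)
  have htail' := ne_top_of_le_ne_top ht htail
  have hmin' := ne_top_of_le_ne_top ht hmin
  rw [← ENNReal.toReal_mul, mul_assoc, ENNReal.inv_mul_cancel hm0 ht, mul_one,
    integral_min_natCast_eq_toReal, sub_le_iff_le_add', ← ENNReal.toReal_add hmin' htail']
  exact ENNReal.toReal_mono (ENNReal.add_ne_top.2 ⟨hmin', htail'⟩)
    (offspringMean_le_add_offspringTail p K θ)

open scoped Topology in
theorem tendsto_div_sqrt_mul_log_log_of_bounds {r : ℕ → ℝ} {C : ℝ}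
    (hl : ∀ᶠ n in atTop, -C ≤ r n) (hu : ∀ᶠ n : ℕ in atTop, r n ≤ 2 * Real.log n) :
    Tendsto (fun n : ℕ => r n / Real.sqrt (n * Real.log (Real.log n))) atTop (𝓝 0) := by
  have hL := tendsto_sqrt_mul_log_log_atTop
  have h1 : Tendsto (fun n : ℕ => -C / Real.sqrt (n * Real.log (Real.log n))) atTop (𝓝 0) :=
    hL.const_div_atTop _
  have h2 : Tendsto (fun n : ℕ => 2 * (Real.log n / (n : ℝ) ^ (1 / 2 : ℝ))) atTop (𝓝 0) := by
    have h := ((isLittleO_log_rpow_atTop (r := 1 / 2) (by norm_num)).tendsto_div_nhds_zero.comp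
      tendsto_natCast_atTop_atTop).const_mul 2
    rw [mul_zero] at h
    exact h
  refine tendsto_of_tendsto_of_tendsto_of_le_of_le' h1 h2 ?_ ?_
  · filter_upwards [hl] with n hn
    exact div_le_div_of_nonneg_right hn (Real.sqrt_nonneg _)
  · filter_upwards [hu, eventually_gt_atTop 0, (Real.tendsto_log_atTop.comp
      (Real.tendsto_log_atTop.comp tendsto_natCast_atTop_atTop)).eventually_ge_atTop 1]
      with n hn hn0 hll
    have hll' : 1 ≤ Real.log (Real.log n) := hll
    have hn0' : (0 : ℝ) < n := by exact_mod_cast hn0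
    rw [← Real.sqrt_eq_rpow, mul_div_assoc']
    have hlog : 0 ≤ Real.log n := Real.log_natCast_nonneg n
    exact div_le_div₀ (by positivity) hn (Real.sqrt_pos.2 hn0')
      (Real.sqrt_le_sqrt (le_mul_of_one_le_right hn0'.le hll'))

/-! ### Almost sure comparison of the population with its quenched mean -/

section Annealed

variable {Ω Θ : Type*} [MeasurableSpace Ω] [MeasurableSpace Θ] {P : Measure Ω}
  [IsProbabilityMeasure P] {p : Kernel Θ ℕ} [IsMarkovKernel p] {ξ : ℕ → Ω → Θ}
  {X : ℕ → ℕ → Ω → ℕ}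

theorem IsBranchingInIIDEnvironment.measurable_populationSize {Ω Θ : Type*} [MeasurableSpace Ω]
    [MeasurableSpace Θ] {P : Measure Ω} {p : Kernel Θ ℕ} [IsMarkovKernel p] {ξ : ℕ → Ω → Θ}
    {X : ℕ → ℕ → Ω → ℕ} (hZ : IsBranchingInIIDEnvironment P p ξ X) (n : ℕ) : Measurable (populationSize X n) :=
  _root_.measurable_populationSize n fun _ _ _ => hZ.measurable_offspring _ _

/-- Otherwise the integral would equal 1, forcing almost every offspring law to be concentrated at
1. The strict inequality gives the geometric decay of E[1/Z_n]. -/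
theorem lintegral_lintegral_inv_natCast_lt_one {θ : Ω → Θ}
    (hp0 : ∀ᵐ ω ∂P, p (θ ω) {0} = 0)
    (hne : ¬ ∀ᵐ ω ∂P, offspringMean p (θ ω) = 1) :
    ∫⁻ ω, ∫⁻ k, (k : ℝ≥0∞)⁻¹ ∂p (θ ω) ∂P < 1 := by
  by_contra hge
  rw [not_lt] at hge
  have hle : (fun ω => ∫⁻ k, (k : ℝ≥0∞)⁻¹ ∂p (θ ω)) ≤ᵐ[P] fun _ => 1 := by
    filter_upwards [hp0] with ω hω
    exact lintegral_inv_natCast_le_one hω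
  have hfin : ∫⁻ ω, ∫⁻ k, (k : ℝ≥0∞)⁻¹ ∂p (θ ω) ∂P ≠ ∞ :=
    ne_top_of_le_ne_top ENNReal.one_ne_top (by simpa using lintegral_mono_ae hle)
  have heq := ae_eq_of_ae_le_of_lintegral_le hle hfin measurable_const.aemeasurable
    (by simpa using hge)
  refine hne ?_
  filter_upwards [heq, hp0] with ω h1 h2
  exact offspringMean_eq_one p h2 h1.ge

/-- The reciprocal of the population has finite expectation, and it would be infinite on extinction.
-/
theorem IsBranchingInIIDEnvironment.ae_populationSize_ne_zero
    (hZ : IsBranchingInIIDEnvironment P p ξ X) (hp0 : ∀ᵐ ω ∂P, p (ξ 0 ω) {0} = 0) :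
    ∀ᵐ ω ∂P, ∀ n, populationSize X n ω ≠ 0 := by
  refine ae_all_iff.2 fun n => ?_
  have hle : ∫⁻ ω, ∫⁻ k, (k : ℝ≥0∞)⁻¹ ∂p (ξ 0 ω) ∂P ≤ 1 := by
    have : (fun ω => ∫⁻ k, (k : ℝ≥0∞)⁻¹ ∂p (ξ 0 ω)) ≤ᵐ[P] fun _ => 1 := by
      filter_upwards [hp0] with ω hω
      exact lintegral_inv_natCast_le_one hω
    simpa using lintegral_mono_ae this
  have hfin : ∫⁻ ω, (populationSize X n ω : ℝ≥0∞)⁻¹ ∂P ≠ ∞ :=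
    ne_top_of_le_ne_top ENNReal.one_ne_top
      ((hZ.lintegral_inv_populationSize_le n).trans (pow_le_one₀ zero_le hle))
  have hm : Measurable fun ω => (populationSize X n ω : ℝ≥0∞)⁻¹ :=
    (measurable_of_countable fun k : ℕ => (k : ℝ≥0∞)⁻¹).comp (hZ.measurable_populationSize n)
  filter_upwards [ae_lt_top hm hfin] with ω hω h0
  simp [h0] at hω

/-- The population exceeds its quenched mean at most by a polynomial factor. -/
theorem IsBranchingInIIDEnvironment.ae_eventually_log_populationSize_le
    (hZ : IsBranchingInIIDEnvironment P p ξ X) (hp0 : ∀ᵐ ω ∂P, p (ξ 0 ω) {0} = 0)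
    (hm1 : ∀ᵐ ω ∂P, ∀ n, 1 ≤ offspringMean p (ξ n ω))
    (hmt : ∀ᵐ ω ∂P, ∀ n, offspringMean p (ξ n ω) ≠ ∞) :
    ∀ᵐ ω ∂P, ∀ᶠ n : ℕ in atTop, Real.log (populationSize X n ω) -
      ∑ k ∈ Finset.range n, Real.log (offspringMean p (ξ k ω)).toReal ≤ 2 * Real.log n := by
  set f : ℕ → Ω → ℝ≥0∞ := fun n ω => (populationSize X n ω : ℝ≥0∞) *
      (∏ k ∈ Finset.range n, offspringMean p (ξ k ω))⁻¹ with hf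
  have hfm : ∀ n, Measurable (f n) := fun n =>
    ((measurable_of_countable fun k : ℕ => (k : ℝ≥0∞)).comp (hZ.measurable_populationSize n)).mul
      (Finset.measurable_prod _ fun k _ =>
        (measurable_offspringMean p).comp (hZ.measurable_env k)).inv
  -- Markov at level n²: the bounds 1/n² are summable, and log n² is the 2 log n of the conclusion.
  have hsum : ∑' n : ℕ, P {ω | ENNReal.ofReal ((n : ℝ) ^ 2) ≤ f n ω} ≠ ∞ := by
    refine ENNReal.tsum_ne_top_of_eventually_le_ofReal (fun _ => measure_ne_top _ _)
      (Real.summable_one_div_nat_pow.2 (show 1 < 2 by norm_num)) ?_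
    filter_upwards [eventually_gt_atTop 0] with n hn
    have hn' : (0 : ℝ) < (n : ℝ) ^ 2 := by positivity
    refine (meas_ge_le_lintegral_div (hfm n).aemeasurable (by simpa using hn'.ne')
      ENNReal.ofReal_ne_top).trans ?_
    rw [ENNReal.ofReal_div_of_pos hn', ENNReal.ofReal_one]
    exact ENNReal.div_le_div_right (hZ.lintegral_populationSize_mul_inv_le n) _
  filter_upwards [ae_eventually_notMem hsum, hm1, hmt, hZ.ae_populationSize_ne_zero hp0]
    with ω hω h1 ht hz
  filter_upwards [hω, eventually_gt_atTop 0] with n hn hn0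
  have hn' : f n ω < ENNReal.ofReal ((n : ℝ) ^ 2) := not_le.1 hn
  set M := ∏ k ∈ Finset.range n, offspringMean p (ξ k ω) with hM
  have hM0 : M ≠ 0 := Finset.prod_ne_zero_iff.2 fun k _ => (lt_of_lt_of_le one_pos (h1 k)).ne'
  have hMt : M ≠ ∞ := ENNReal.prod_ne_top fun k _ => ht k
  have hle : (populationSize X n ω : ℝ≥0∞) ≤ ENNReal.ofReal ((n : ℝ) ^ 2) * M := by
    refine (ENNReal.div_le_iff_le_mul (Or.inl hM0) (Or.inl hMt)).1 ?_
    rw [div_eq_mul_inv]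
    exact hn'.le
  have hreal := ENNReal.toReal_mono (ENNReal.mul_ne_top ENNReal.ofReal_ne_top hMt) hle
  rw [ENNReal.toReal_natCast, ENNReal.toReal_mul, ENNReal.toReal_ofReal (by positivity), hM,
    ENNReal.toReal_prod] at hreal
  have hpos : ∀ k, (0 : ℝ) < (offspringMean p (ξ k ω)).toReal := fun k =>
    ENNReal.toReal_pos (lt_of_lt_of_le one_pos (h1 k)).ne' (ht k)
  have hn0' : (0 : ℝ) < n := by exact_mod_cast hn0
  have hlog := Real.log_le_log (by exact_mod_cast Nat.pos_of_ne_zero (hz n)) hreal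
  rw [Real.log_mul (by positivity) (Finset.prod_pos fun k _ => hpos k).ne', Real.log_pow,
    Real.log_prod fun k _ => (hpos k).ne'] at hlog
  push_cast at hlog
  linarith

theorem IsBranchingInIIDEnvironment.lintegral_offspring_mul
    (hZ : IsBranchingInIIDEnvironment P p ξ X) {g : ℕ → ℝ≥0∞} (hg : Measurable g) {h : Θ → ℝ≥0∞}
    (hh : Measurable h) :
    ∫⁻ ω, g (X 0 0 ω) * h (ξ 0 ω) ∂P = ∫⁻ ω, (∫⁻ k, g k ∂p (ξ 0 ω)) * h (ξ 0 ω) ∂P := by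
  have hx : Measurable fun x : ℕ × ℕ → ℕ => g (x (0, 0)) := hg.comp (measurable_pi_apply _)
  have hF : Measurable fun w : (ℕ → Θ) × (ℕ × ℕ → ℕ) => g (w.2 (0, 0)) * h (w.1 0) :=
    (hx.comp measurable_snd).mul (hh.comp ((measurable_pi_apply 0).comp measurable_fst))
  have key : ∀ e : ℕ → Θ, ∫⁻ x, g (x (0, 0)) ∂quenchedLaw p e = ∫⁻ k, g k ∂p (e 0) := fun e => by
    have hmap : (quenchedLaw p e).map (fun x => x (0, 0)) = p (e 0) :=
      Measure.infinitePi_map_eval (fun q : ℕ × ℕ => p (e q.1)) (0, 0)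
    rw [← hmap, lintegral_map hg (measurable_pi_apply _)]
  rw [hZ.lintegral_eq hF]
  refine lintegral_congr fun ω => ?_
  dsimp only
  rw [lintegral_mul_const _ hx, key]

/-- Under the `Z log Z` condition, truncation at a geometric level costs a summable part of the
offspring means. -/
theorem IsBranchingInIIDEnvironment.ae_tsum_offspringTail_ne_top
    (hZ : IsBranchingInIIDEnvironment P p ξ X)
    (hm1 : ∀ᵐ ω ∂P, 1 ≤ offspringMean p (ξ 0 ω)) (hmt : ∀ᵐ ω ∂P, offspringMean p (ξ 0 ω) ≠ ∞)
    (hZlogZ : Integrable (fun ω =>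
      (populationSize X 1 ω : ℝ) / (offspringMean p (ξ 0 ω)).toReal *
        Real.log (populationSize X 1 ω)) P) {s : ℝ} (hs : 1 < s) :
    ∀ᵐ ω ∂P, ∑' n : ℕ, offspringTail p ⌈s ^ n⌉₊ (ξ n ω) * (offspringMean p (ξ n ω))⁻¹ ≠ ∞ := by
  have hls : 0 < Real.log s := Real.log_pos hs
  have hηm : ∀ n : ℕ, Measurable fun θ => offspringTail p ⌈s ^ n⌉₊ θ * (offspringMean p θ)⁻¹ :=
    fun n => (measurable_offspringTail p _).mul (measurable_offspringMean p).inv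
  set g : ℕ → ℝ≥0∞ := fun k => k * ENNReal.ofReal (1 + Real.log k / Real.log s) with hg
  have hgm : Measurable g := measurable_of_countable g
  have hηξ : ∀ n i : ℕ, Measurable fun ω =>
      offspringTail p ⌈s ^ n⌉₊ (ξ i ω) * (offspringMean p (ξ i ω))⁻¹ :=
    fun n i => (hηm n).comp (hZ.measurable_env i)
  have hZ1m : Measurable fun ω =>
      (populationSize X 1 ω : ℝ≥0∞) * (offspringMean p (ξ 0 ω))⁻¹ :=
    ((measurable_of_countable fun k : ℕ => (k : ℝ≥0∞)).comp (hZ.measurable_populationSize 1)).mul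
      ((measurable_offspringMean p).comp (hZ.measurable_env 0)).inv
  have hZ1 : ∀ ω, populationSize X 1 ω = X 0 0 ω := fun ω => by simp [populationSize]
  have hlint : ∫⁻ ω, (∫⁻ k, g k ∂p (ξ 0 ω)) * (offspringMean p (ξ 0 ω))⁻¹ ∂P =
      ∫⁻ ω, g (populationSize X 1 ω) * (offspringMean p (ξ 0 ω))⁻¹ ∂P := by
    simp only [hZ1]
    exact (hZ.lintegral_offspring_mul hgm (measurable_offspringMean p).inv).symm
  have hfin : ∫⁻ ω, g (populationSize X 1 ω) * (offspringMean p (ξ 0 ω))⁻¹ ∂P ≠ ∞ := by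
    have h1 : ∫⁻ ω, (populationSize X 1 ω : ℝ≥0∞) * (offspringMean p (ξ 0 ω))⁻¹ ∂P ≤ 1 := by
      simpa using hZ.lintegral_populationSize_mul_inv_le 1
    have h2 := hZlogZ.lintegral_lt_top
    have hbound : (fun ω => g (populationSize X 1 ω) * (offspringMean p (ξ 0 ω))⁻¹) =ᵐ[P]
        fun ω => (populationSize X 1 ω : ℝ≥0∞) * (offspringMean p (ξ 0 ω))⁻¹ +
          ENNReal.ofReal ((populationSize X 1 ω : ℝ) / (offspringMean p (ξ 0 ω)).toReal *
            Real.log (populationSize X 1 ω)) * ENNReal.ofReal (Real.log s)⁻¹ := by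
      filter_upwards [hm1, hmt] with ω e1 e2
      have hlk : 0 ≤ Real.log (populationSize X 1 ω) := Real.log_natCast_nonneg _
      have hpos : 0 < (offspringMean p (ξ 0 ω)).toReal :=
        ENNReal.toReal_pos (lt_of_lt_of_le one_pos e1).ne' e2
      rw [← ENNReal.ofReal_toReal e2, ENNReal.toReal_ofReal hpos.le,
        ← ENNReal.ofReal_inv_of_pos hpos, ← ENNReal.ofReal_natCast, hg]
      dsimp only
      rw [← ENNReal.ofReal_natCast, ← ENNReal.ofReal_mul (by positivity),
        ← ENNReal.ofReal_mul (by positivity), ← ENNReal.ofReal_mul (by positivity),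
        ← ENNReal.ofReal_mul (by positivity), ← ENNReal.ofReal_add (by positivity) (by positivity)]
      congr 1
      ring
    rw [lintegral_congr_ae hbound, lintegral_add_left hZ1m,
      lintegral_mul_const' _ _ ENNReal.ofReal_ne_top]
    exact ENNReal.add_ne_top.2 ⟨ne_top_of_le_ne_top ENNReal.one_ne_top h1,
      ENNReal.mul_ne_top h2.ne ENNReal.ofReal_ne_top⟩
  have hsum : ∫⁻ ω, ∑' n : ℕ, offspringTail p ⌈s ^ n⌉₊ (ξ n ω) * (offspringMean p (ξ n ω))⁻¹ ∂P
      ≠ ∞ := by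
    rw [lintegral_tsum fun n => (hηξ n n).aemeasurable]
    -- Replacing the n-th environment by the initial one inside each expectation lets the sum over n
    -- be taken under a single offspring law, where the indices can be counted.
    have hid : ∀ n, ∫⁻ ω, offspringTail p ⌈s ^ n⌉₊ (ξ n ω) * (offspringMean p (ξ n ω))⁻¹ ∂P =
        ∫⁻ ω, offspringTail p ⌈s ^ n⌉₊ (ξ 0 ω) * (offspringMean p (ξ 0 ω))⁻¹ ∂P := fun n =>
      ((hZ.identDistrib_env n).comp (hηm n)).lintegral_eq
    simp only [hid]
    rw [← lintegral_tsum fun n => (hηξ n 0).aemeasurable]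
    refine ne_top_of_le_ne_top hfin (le_trans (lintegral_mono fun ω => ?_) hlint.le)
    rw [ENNReal.tsum_mul_right]
    refine mul_le_mul_left ?_ _
    simp only [offspringTail]
    rw [← lintegral_tsum fun n => (measurable_of_countable _).aemeasurable]
    exact lintegral_mono fun k => tsum_ite_ceil_pow_lt_le hs k
  have hmeas : Measurable fun ω =>
      ∑' n : ℕ, offspringTail p ⌈s ^ n⌉₊ (ξ n ω) * (offspringMean p (ξ n ω))⁻¹ :=
    Measurable.tsum fun n => hηξ n n
  filter_upwards [ae_lt_top hmeas hsum] with ω hω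
  exact hω.ne

/-- Under the `Z log Z` condition, the population falls short of its quenched mean at most by a
random constant factor. -/
theorem IsBranchingInIIDEnvironment.ae_exists_log_populationSize_ge
    (hZ : IsBranchingInIIDEnvironment P p ξ X) (hp0 : ∀ᵐ ω ∂P, ∀ n, p (ξ n ω) {0} = 0)
    (hmt : ∀ᵐ ω ∂P, ∀ n, offspringMean p (ξ n ω) ≠ ∞)
    (hne : ¬ ∀ᵐ ω ∂P, offspringMean p (ξ 0 ω) = 1)
    (hZlogZ : Integrable (fun ω =>
      (populationSize X 1 ω : ℝ) / (offspringMean p (ξ 0 ω)).toReal *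
        Real.log (populationSize X 1 ω)) P) :
    ∀ᵐ ω ∂P, ∃ C, ∀ᶠ n : ℕ in atTop, -C ≤ Real.log (populationSize X n ω) -
      ∑ k ∈ Finset.range n, Real.log (offspringMean p (ξ k ω)).toReal := by
  have hp00 : ∀ᵐ ω ∂P, p (ξ 0 ω) {0} = 0 := hp0.mono fun ω h => h 0
  obtain ⟨ρ, hρ0, hρ1, hρ⟩ : ∃ ρ : ℝ, 0 < ρ ∧ ρ < 1 ∧
      ∫⁻ ω, ∫⁻ k, (k : ℝ≥0∞)⁻¹ ∂p (ξ 0 ω) ∂P ≤ ENNReal.ofReal ρ := by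
    have hlt := lintegral_lintegral_inv_natCast_lt_one hp00 hne
    obtain ⟨ρ, h1, h2⟩ := exists_between hlt
    have hρt : ρ ≠ ∞ := (h2.trans ENNReal.one_lt_top).ne
    refine ⟨ρ.toReal, ENNReal.toReal_pos (lt_of_le_of_lt zero_le h1).ne' hρt, ?_, ?_⟩
    · rw [← ENNReal.toReal_one]; exact (ENNReal.toReal_lt_toReal hρt ENNReal.one_ne_top).2 h2
    · rw [ENNReal.ofReal_toReal hρt]; exact h1.le
  -- The Chebyshev bound for generation n is of order s^n ε_n^(-2) ρ^n. With sρ < 1 and ε_n =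
  -- (n+1)^(-2), it is a polynomial times a geometric term, while ε_n stays summable.
  obtain ⟨s, hs1, hs⟩ : ∃ s, 1 < s ∧ s < 1 / ρ :=
    exists_between (by rw [lt_div_iff₀ hρ0]; linarith)
  have hsρ : s * ρ < 1 := by rwa [lt_div_iff₀ hρ0] at hs
  have hs0 : 0 < s := by linarith
  set K : ℕ → ℕ := fun n => ⌈s ^ n⌉₊ with hK
  have hK1 : ∀ n, 1 ≤ K n := fun n => Nat.one_le_ceil_iff.2 (by positivity)
  set ε : ℕ → ℝ := fun n => 1 / ((n + 1 : ℕ) : ℝ) ^ 2 with hε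
  have hεpos : ∀ n, 0 < ε n := fun n => by simp only [hε]; positivity
  have hεsum : Summable ε :=
    (summable_nat_add_iff 1).2 (Real.summable_one_div_nat_pow.2 (show 1 < 2 by norm_num))
  have hbad : ∑' n, P {ω | (populationSize X (n + 1) ω : ℝ) <
      (1 - ε n) * (∫ k, ((min k (K n) : ℕ) : ℝ) ∂p (ξ n ω)) * populationSize X n ω} ≠ ∞ := by
    have hgeo : Summable fun n : ℕ => 2 / (s * ρ) * (((n + 1 : ℕ) : ℝ) ^ 4 * (s * ρ) ^ (n + 1)) :=
      ((summable_nat_add_iff 1).2 (summable_pow_mul_geometric_of_norm_lt_one 4 (r := s * ρ)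
        (by rw [Real.norm_of_nonneg (by positivity)]; exact hsρ))).mul_left _
    refine ENNReal.tsum_ne_top_of_eventually_le_ofReal (fun _ => measure_ne_top _ _) hgeo
      (Eventually.of_forall fun n => ?_)
    refine (hZ.measure_populationSize_succ_lt_le hp0 n (hK1 n) (hεpos n)).trans ?_
    calc ENNReal.ofReal (K n / ε n ^ 2) * ∫⁻ ω, (populationSize X n ω : ℝ≥0∞)⁻¹ ∂P
        ≤ ENNReal.ofReal (K n / ε n ^ 2) * ENNReal.ofReal ρ ^ n :=
          mul_le_mul_right ((hZ.lintegral_inv_populationSize_le n).trans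
            (pow_le_pow_left' hρ n)) _
      _ = ENNReal.ofReal (K n / ε n ^ 2 * ρ ^ n) := by
          rw [← ENNReal.ofReal_pow hρ0.le,
            ← ENNReal.ofReal_mul (div_nonneg (Nat.cast_nonneg _) (sq_nonneg _))]
      _ ≤ _ := by
          refine ENNReal.ofReal_le_ofReal ?_
          have hKle : (K n : ℝ) ≤ 2 * s ^ n := by
            have h1 := (Nat.ceil_lt_add_one (show 0 ≤ s ^ n by positivity)).le
            have h2 := one_le_pow₀ hs1.le (n := n)
            simp only [hK]; linarith
          have e : 2 / (s * ρ) * (((n + 1 : ℕ) : ℝ) ^ 4 * (s * ρ) ^ (n + 1)) =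
              2 * s ^ n / ε n ^ 2 * ρ ^ n := by
            simp only [hε]
            rw [pow_succ (s * ρ), mul_pow]
            field_simp
          rw [e]
          exact mul_le_mul_of_nonneg_right (div_le_div_of_nonneg_right hKle (sq_nonneg _))
            (by positivity)
  filter_upwards [ae_eventually_notMem hbad, hp0, hmt, hZ.ae_populationSize_ne_zero hp00,
    hZ.ae_tsum_offspringTail_ne_top (hp00.mono fun ω h => one_le_offspringMean p h)
      (hmt.mono fun ω h => h 0) hZlogZ hs1] with ω h1 h2 h3 h4 h5
  obtain ⟨C, hC⟩ := exists_log_ge_sum_log_sub (z := fun n => (populationSize X n ω : ℝ))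
    (m := fun n => (offspringMean p (ξ n ω)).toReal)
    (a := fun n => ∫ k, ((min k (K n) : ℕ) : ℝ) ∂p (ξ n ω))
    (η := fun n => (offspringTail p (K n) (ξ n ω) * (offspringMean p (ξ n ω))⁻¹).toReal)
    (ε := ε) (fun n => by exact_mod_cast Nat.one_le_iff_ne_zero.2 (h4 n))
    (fun n => by
      rw [← ENNReal.toReal_one]
      exact ENNReal.toReal_mono (h3 n) (one_le_offspringMean p (h2 n)))
    (fun n => ENNReal.toReal_nonneg)
    (ENNReal.summable_toReal h5) (fun n => (hεpos n).le) hεsum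
    (fun n => toReal_offspringMean_sub_le p (K n) (h2 n) (h3 n))
    (h1.mono fun n hn => not_lt.1 hn)
  exact ⟨C, hC.mono fun n hn => by linarith⟩

end Annealed

/-! ### The main theorem -/

theorem theorem1 {Ω Θ : Type*} [MeasurableSpace Ω] [MeasurableSpace Θ]
    (P : Measure Ω) [IsProbabilityMeasure P]
    (p : Kernel Θ ℕ) [IsMarkovKernel p]
    (ξ : ℕ → Ω → Θ) (X : ℕ → ℕ → Ω → ℕ)
    (hZ : IsBranchingInIIDEnvironment P p ξ X)
    -- `p_0(ξ_0) = 0` almost surely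
    (hp0 : ∀ᵐ ω ∂P, p (ξ 0 ω) {0} = 0)
    -- `E (log m_0)^(2 + δ) < ∞` (in particular `m_0 < ∞` almost surely)
    (δ : ℝ) (hδ : δ ∈ Set.Ioo (0 : ℝ) 1)
    (hmoment : ∫⁻ ω, (ENNReal.log (offspringMean p (ξ 0 ω))).toENNReal ^ (2 + δ) ∂P < ∞)
    -- supercriticality: `μ = E log m_0 > 0`
    (μ : ℝ) (hμ_def : μ = ∫ ω, logMean p ξ ω ∂P) (hμ : 0 < μ)
    -- `σ² = E (log m_0 - μ)²` with `σ ∈ (0, ∞)`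
    (σ : ℝ) (hσ : 0 < σ) (hσ_def : ENNReal.ofReal (σ ^ 2) = evariance (logMean p ξ) P)
    -- `E [(Z_1 / m_0) log Z_1] < ∞`
    (hZlogZ : Integrable (fun ω =>
      (populationSize X 1 ω : ℝ) / (offspringMean p (ξ 0 ω)).toReal *
        Real.log (populationSize X 1 ω)) P) :
    (∀ᵐ ω ∂P, limsup (fun n : ℕ =>
      (((Real.log (populationSize X n ω) - n * μ) /
        Real.sqrt (n * Real.log (Real.log n)) : ℝ) : EReal)) atTop
          = ((Real.sqrt 2 * σ : ℝ) : EReal)) ∧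
    (∀ᵐ ω ∂P, liminf (fun n : ℕ =>
      (((Real.log (populationSize X n ω) - n * μ) /
        Real.sqrt (n * Real.log (Real.log n)) : ℝ) : EReal)) atTop
          = ((-(Real.sqrt 2 * σ) : ℝ) : EReal)) := by
  have hms := measurable_offspringMean p
  have hp0s : MeasurableSet {θ : Θ | p θ {0} = 0} :=
    measurableSet_eq_fun (p.measurable_coe (measurableSet_singleton 0)) measurable_const
  have hmts : MeasurableSet {θ : Θ | offspringMean p θ ≠ ∞} :=
    (measurableSet_eq_fun hms measurable_const).compl
  have hp0' : ∀ᵐ ω ∂P, ∀ n, p (ξ n ω) {0} = 0 := hZ.ae_env hp0s hp0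
  have hδ2 : 0 < 2 + δ := by have := hδ.1; linarith
  -- The extended logarithm of ∞ is ∞, so the moment condition excludes infinite means.
  have hmt0 : ∀ᵐ ω ∂P, offspringMean p (ξ 0 ω) ≠ ∞ := by
    have hm : Measurable fun ω => (ENNReal.log (offspringMean p (ξ 0 ω))).toENNReal ^ (2 + δ) :=
      ((ENNReal.measurable_log.comp
        (hms.comp (hZ.measurable_env 0))).ereal_toENNReal).pow_const _
    filter_upwards [ae_lt_top hm hmoment.ne] with ω hω htop
    rw [htop, ENNReal.log_top, EReal.toENNReal_top, ENNReal.top_rpow_of_pos hδ2] at hω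
    exact lt_irrefl _ hω
  have hmt : ∀ᵐ ω ∂P, ∀ n, offspringMean p (ξ n ω) ≠ ∞ := hZ.ae_env hmts hmt0
  have hm1 : ∀ᵐ ω ∂P, ∀ n, 1 ≤ offspringMean p (ξ n ω) := by
    filter_upwards [hp0'] with ω hω n
    exact one_le_offspringMean p (hω n)
  -- Means almost surely equal to 1 would give μ = 0.
  have hne : ¬ ∀ᵐ ω ∂P, offspringMean p (ξ 0 ω) = 1 := fun h => by
    have h0 : logMean p ξ =ᵐ[P] fun _ => 0 := by
      filter_upwards [h] with ω hω
      simp [logMean, hω]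
    rw [hμ_def, integral_congr_ae h0, integral_zero] at hμ
    exact lt_irrefl _ hμ
  set φ : Θ → ℝ := fun θ => Real.log (offspringMean p θ).toReal with hφ
  have hφm : Measurable φ := Real.measurable_log.comp hms.ennreal_toReal
  have hUm : ∀ k, Measurable fun ω => φ (ξ k ω) := fun k => hφm.comp (hZ.measurable_env k)
  -- `toENNReal` keeps only the positive part of the logarithm; as the mean is at least 1, nothing
  -- is lost.
  have hmom : MemLp (fun ω => φ (ξ 0 ω)) (ENNReal.ofReal (2 + δ)) P := by
    refine ⟨(hUm 0).aestronglyMeasurable, ?_⟩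
    rw [eLpNorm_lt_top_iff_lintegral_rpow_enorm_lt_top (by simpa using hδ2) ENNReal.ofReal_ne_top,
      ENNReal.toReal_ofReal hδ2.le]
    refine lt_of_le_of_lt (le_of_eq (lintegral_congr_ae ?_)) hmoment
    filter_upwards [hm1, hmt0] with ω h1 h2
    have hpos := lt_of_lt_of_le one_pos (h1 0)
    have h1' : 1 ≤ (offspringMean p (ξ 0 ω)).toReal := by
      rw [← ENNReal.toReal_one]; exact ENNReal.toReal_mono h2 (h1 0)
    rw [ENNReal.log_pos_real hpos.ne' h2, EReal.toENNReal_of_ne_top (EReal.coe_ne_top _),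
      EReal.toReal_coe, Real.enorm_of_nonneg (Real.log_nonneg h1')]
  have hvar : ∫ ω, (φ (ξ 0 ω) - μ) ^ 2 ∂P = σ ^ 2 := by
    have h := variance_eq_integral (μ := P) (X := logMean p ξ) (hUm 0).aemeasurable
    rw [variance, ← hσ_def, ENNReal.toReal_ofReal (sq_nonneg σ), ← hμ_def] at h
    exact h.symm
  refine ae_limsup_liminf_perturbed_sum hUm (hZ.indep_env.comp (fun _ => φ) fun _ => hφm)
    (fun k => (hZ.identDistrib_env k).comp hφm) (γ := 2 + δ) (by have := hδ.1; linarith) hmom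
    hμ_def.symm hσ hvar ?_
  filter_upwards [hZ.ae_eventually_log_populationSize_le hp0 hm1 hmt,
    hZ.ae_exists_log_populationSize_ge hp0' hmt hne hZlogZ] with ω hu hl
  obtain ⟨C, hC⟩ := hl
  exact tendsto_div_sqrt_mul_log_log_of_bounds hC hu
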